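/- Let $G \subset GL(n,\mathbb C)$ be a compact connected matrix Lie group with Lie algebra $\mathfrak g$. On $\mathbb R^{1+3}$ use Cartesian coordinates $(x^0,x^1,x^2,x^3)=(t,x)$, the Minkowski metric of signature $(-+++)$ and its Hodge star $\star$. Let $$\mathbb D=\{(t,x)\in\mathbb R^{1+3} : |x|\le t+1,\ |x|\le 1-t\},\qquad \partial^-\mathbb D=\{(t,x)\in\mathbb D : |x|=t+1\},$$ and, for a fixed $0<\epsilon_0<1$, let $\mho=\{(t,x)\in \operatorname{int}\mathbb D : |x|<\epsilon_0\}$. For a $\mathfrak g$-valued $1$-form $A$ write $d_A\omega=d\omega+[A,\omega]$, $F_A=dA+\tfrac12[A,A]$ and $d_A^*=\star d_A\star$. For $\mathbf U\in C^\infty(\mathbb D;G)$ write $\mathbf U\cdot B=\mathbf U^{-1}d\mathbf U+\mathbf U^{-1}B\mathbf U$. "Near $\partial^-\mathbb D$" means in the intersection of $\mathbb D$ with some open set containing $\partial^-\mathbb D$. Let $A,B\in C^3(\mathbb D;T^*\mathbb D\otimes\mathfrak g)$ be in temporal gauge, that is, $A_0=B_0=0$ in $\mathbb D$. Suppose that $d_A^*F_A=0=d_B^*F_B$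 in $\mathbb D\setminus\mho$ and that $d_A^*F_A=d_B^*F_B$ in $\mho$. Let $\mathbf U\in C^\infty(\mathbb D;G)$ and let $\mathcal N\supset\partial^-\mathbb D$ be an open set such that $A=\mathbf U\cdot B$ in $\mathcal N\cap\mathbb D$; suppose also that $\mathbf U=\mathrm{id}$ in $\mho$ near $\partial^-\mathbb D$. Then $\partial_t\mathbf U=0$ in $\mathcal N\cap\mathbb D$, and there is $\mathbf V\in C^\infty(\mathbb D;G)$ that does not depend on $t$ in $\mathbb D$, coincides with $\mathbf U$ near $\partial^-\mathbb D$ (so that necessarily $\mathbf V(t,x)=\mathbf U(|x|-1,x)$), and satisfies $A=\mathbf V\cdot B$ in all of $\mathbb D$. -/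

import Mathlib

open Set Topology
open scoped ContDiff Matrix.Norms.L2Operator

noncomputable section

namespace YM

/-- Space-time `ℝ^{1+3}`, with points `z = (t, x)`. -/
abbrev Spacetime : Type := ℝ × EuclideanSpace ℝ (Fin 3)

/-- The complex `n × n` matrices, as a real vector space. They carry the `ℓ²` operator norm. -/
abbrev Mat (n : ℕ) : Type := Matrix (Fin n) (Fin n) ℂ

/-! ### Minkowski space -/

/-- The Cartesian coordinate covectors `dx⁰ = dt, dx¹, dx², dx³`. -/
def dx (μ : Fin 4) : Spacetime →L[ℝ] ℝ :=
  Fin.cases (ContinuousLinearMap.fst ℝ ℝ (EuclideanSpace ℝ (Fin 3)))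
    (fun j => (EuclideanSpace.proj j).comp
      (ContinuousLinearMap.snd ℝ ℝ (EuclideanSpace ℝ (Fin 3)))) μ

/-- The Cartesian coordinate vectors `∂₀ = ∂_t, ∂₁, ∂₂, ∂₃`. -/
def e (μ : Fin 4) : Spacetime :=
  Fin.cases (1, 0) (fun j => (0, EuclideanSpace.single j 1)) μ

/-- The diagonal entries `g^{μμ}` of the (diagonal) Minkowski metric, of signature `(- + + +)`. -/
def g (μ : Fin 4) : ℝ := if μ = 0 then -1 else 1

/-- The volume form `dx⁰ ∧ dx¹ ∧ dx² ∧ dx³`. -/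
def vol : Spacetime [⋀^Fin 4]→L[ℝ] ℝ :=
  { (Matrix.detRowAlternating (R := ℝ) (n := Fin 4)).compLinearMap
      (LinearMap.pi fun μ => (dx μ).toLinearMap) with
    cont := by
      change Continuous fun v : Fin 4 → Spacetime => Matrix.det (Matrix.of fun i μ => dx μ (v i))
      exact Continuous.matrix_det (continuous_matrix fun i μ =>
        (dx μ).continuous.comp (continuous_apply i)) }

/-- The interior product `w(v₀, …, v_{k-1}, ·, …, ·)`. -/
def contract {l : ℕ} : (k : ℕ) → (Fin k → Spacetime) →
    (Spacetime [⋀^Fin (l + k)]→L[ℝ] ℝ) → (Spacetime [⋀^Fin l]→L[ℝ] ℝ)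
  | 0, _, w => w
  | k + 1, v, w => contract k (fun i => v i.succ)
      ((show Spacetime [⋀^Fin ((l + k) + 1)]→L[ℝ] ℝ from w).curryLeft (v 0))

/-- The Hodge star of a matrix-valued `k`-form (at a point), where `l = 4 - k`:
`(⋆η)(v₁, …, v_l) = (1/k!) ∑_α η^{α₁…α_k} vol(∂_{α₁}, …, ∂_{α_k}, v₁, …, v_l)`.
This is the map with `w ∧ ⋆η = ⟨w, η⟩ vol`. -/
def hodge {n k l : ℕ} (h : l + k = 4) (η : Spacetime [⋀^Fin k]→L[ℝ] Mat n) :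
    Spacetime [⋀^Fin l]→L[ℝ] Mat n :=
  ((k.factorial : ℝ)⁻¹) • ∑ α : Fin k → Fin 4,
    (∏ i, g (α i)) •
      (contract k (fun i => e (α i)) (h ▸ vol)).smulRight (η fun i => e (α i))

/-! ### The causal diamond -/

/-- The causal diamond `𝔻`. -/
def diamond : Set Spacetime := {z | ‖z.2‖ ≤ z.1 + 1 ∧ ‖z.2‖ ≤ 1 - z.1}

/-- The observation set `℧`. -/
def obs (ε₀ : ℝ) : Set Spacetime := {z | z ∈ interior diamond ∧ ‖z.2‖ < ε₀}

/-- The lower boundary `∂⁻𝔻`. -/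
def lowerBdry : Set Spacetime := {z | z ∈ diamond ∧ ‖z.2‖ = z.1 + 1}

/-! ### Matrix groups, connections and gauge transformations -/

/-- The Lie algebra of a closed matrix group. -/
def lieAlg {n : ℕ} (G : Subgroup (GL (Fin n) ℂ)) : Set (Mat n) :=
  {X | ∀ s : ℝ, ∃ a ∈ G, (a : Mat n) = NormedSpace.exp (s • X)}

/-- `A ∈ C³(𝔻; T*𝔻 ⊗ 𝔤)`, with derivatives up to the boundary of `𝔻`. -/
structure IsConnection {n : ℕ} (G : Subgroup (GL (Fin n) ℂ))
    (A : Spacetime → Spacetime →L[ℝ] Mat n) : Prop where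
  contDiffOn : ContDiffOn ℝ 3 A diamond
  mem_lieAlg : ∀ z ∈ diamond, ∀ v, A z v ∈ lieAlg G

/-- `U ∈ C^∞(𝔻; G)`, with derivatives up to the boundary of `𝔻`. -/
structure IsGauge {n : ℕ} (G : Subgroup (GL (Fin n) ℂ))
    (U : Spacetime → GL (Fin n) ℂ) : Prop where
  contDiffOn : ContDiffOn ℝ ∞ (fun z => (U z : Mat n)) diamond
  mem : ∀ z ∈ diamond, U z ∈ G

/-- The differential `dU` on `𝔻` of a gauge transformation. -/
def dGauge {n : ℕ} (U : Spacetime → GL (Fin n) ℂ) (z : Spacetime) : Spacetime →L[ℝ] Mat n :=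
  fderivWithin ℝ (fun y => (U y : Mat n)) diamond z

/-- The gauge action `U · B = U⁻¹ dU + U⁻¹ B U`. -/
def gaugeAct {n : ℕ} (U : Spacetime → GL (Fin n) ℂ) (B : Spacetime → Spacetime →L[ℝ] Mat n)
    (z : Spacetime) : Spacetime →L[ℝ] Mat n :=
  (ContinuousLinearMap.mul ℝ (Mat n) ((U z)⁻¹ : GL (Fin n) ℂ)).comp
    (dGauge U z + ((ContinuousLinearMap.mul ℝ (Mat n)).flip (U z : Mat n)).comp (B z))

/-- Temporal gauge: `A₀ = 0` in `𝔻`. -/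
def IsTemporal {n : ℕ} (A : Spacetime → Spacetime →L[ℝ] Mat n) : Prop :=
  ∀ z ∈ diamond, A z (e 0) = 0

/-! ### Covariant derivative and curvature -/

/-- The commutator `X ↦ (Y ↦ X Y - Y X)`. -/
def ad (n : ℕ) : Mat n →L[ℝ] Mat n →L[ℝ] Mat n :=
  ContinuousLinearMap.mul ℝ (Mat n) - (ContinuousLinearMap.mul ℝ (Mat n)).flip

/-- The pairing `[a, w] = a ∧ w - (-1)^k w ∧ a` of a `1`-form with a `k`-form (at a point), that is
`[a, w](v₀, …, v_k) = ∑ᵢ (-1)^i [a(vᵢ), w(v₀, …, v̂ᵢ, …, v_k)]`. -/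
def bracket {n k : ℕ} (a : Spacetime →L[ℝ] Mat n) (w : Spacetime [⋀^Fin k]→L[ℝ] Mat n) :
    Spacetime [⋀^Fin (k + 1)]→L[ℝ] Mat n :=
  .alternatizeUncurryFin
    (((ContinuousLinearMap.compContinuousAlternatingMapCLM ℝ Spacetime (Mat n) (Mat n)
      (ι := Fin k)).flip w).comp ((ad n).comp a))

/-- A `1`-form as an alternating form of degree `1`. -/
def oneForm {n : ℕ} (a : Spacetime →L[ℝ] Mat n) : Spacetime [⋀^Fin 1]→L[ℝ] Mat n :=
  ContinuousAlternatingMap.ofSubsingleton ℝ Spacetime (Mat n) (0 : Fin 1) a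

/-- The covariant derivative `d_A w = dw + [A, w]` on `𝔻`. -/
def covD {n k : ℕ} (A : Spacetime → Spacetime →L[ℝ] Mat n)
    (w : Spacetime → Spacetime [⋀^Fin k]→L[ℝ] Mat n) (z : Spacetime) :
    Spacetime [⋀^Fin (k + 1)]→L[ℝ] Mat n :=
  extDerivWithin w diamond z + bracket (A z) (w z)

/-- The curvature `F_A = dA + [A, A] / 2` on `𝔻`. -/
def curvature {n : ℕ} (A : Spacetime → Spacetime →L[ℝ] Mat n) (z : Spacetime) :
    Spacetime [⋀^Fin 2]→L[ℝ] Mat n :=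
  extDerivWithin (fun y => oneForm (A y)) diamond z
    + (2⁻¹ : ℝ) • bracket (A z) (oneForm (A z))

/-- The `1`-form `d_A^* F_A = ⋆ d_A ⋆ F_A` on `𝔻`. -/
def source {n : ℕ} (A : Spacetime → Spacetime →L[ℝ] Mat n) (z : Spacetime) :
    Spacetime [⋀^Fin 1]→L[ℝ] Mat n :=
  hodge (k := 3) (l := 1) rfl
    (covD A (fun y => hodge (k := 2) (l := 2) rfl (curvature A y)) z)

end YM

end

/-! The static extension `V` of `U` from the lower boundary turns `B` into a connection `V · B` that
is again in temporal gauge and agrees with `A` near the lower boundary. Since `d_A^* F_A` transforms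
by conjugation and `V = 1` on the observation set, `A` and `V · B` also have the same source. In
temporal gauge the equation for the source, the Bianchi identity and `∂_t A_k = F_{0k}` make up a
semilinear symmetric hyperbolic system of Maxwell type for `A` and its electric and magnetic fields.
Its characteristic speeds are at most one, so that its solutions in the diamond are determined near
the lower boundary, and `A = V · B`. -/

noncomputable section

namespace YM

/-! ### Geometry of the diamond -/

theorem isClosed_diamond : IsClosed diamond :=
  (isClosed_le (f := fun z : Spacetime => ‖z.2‖) (g := fun z => z.1 + 1)
    (by fun_prop) (by fun_prop)).inter
  (isClosed_le (f := fun z : Spacetime => ‖z.2‖) (g := fun z => 1 - z.1)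
    (by fun_prop) (by fun_prop))

theorem isCompact_diamond : IsCompact diamond := by
  refine Metric.isCompact_of_isClosed_isBounded isClosed_diamond
    ((Metric.isBounded_closedBall (x := (0 : Spacetime)) (r := 1)).subset fun z hz => ?_)
  have hnonneg := norm_nonneg z.2
  rw [mem_closedBall_zero_iff, Prod.norm_def, max_le_iff, Real.norm_eq_abs, abs_le]
  exact ⟨⟨by linarith [hz.1], by linarith [hz.2]⟩, by linarith [hz.1, hz.2]⟩

theorem isCompact_lowerBdry : IsCompact lowerBdry :=
  isCompact_diamond.inter_right (isClosed_eq (by fun_prop) (by fun_prop))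

theorem convex_diamond : Convex ℝ diamond := by
  have hnorm : ConvexOn ℝ univ fun z : Spacetime => ‖z.2‖ :=
    (convexOn_norm (convex_univ (E := EuclideanSpace ℝ (Fin 3)))).comp_linearMap
      (LinearMap.snd ℝ ℝ (EuclideanSpace ℝ (Fin 3)))
  rintro y ⟨hy_lower, hy_upper⟩ z ⟨hz_lower, hz_upper⟩ a b ha hb hab
  have hle := hnorm.2 (mem_univ y) (mem_univ z) ha hb hab
  simp only [smul_eq_mul] at hle
  constructor <;> refine hle.trans ?_ <;>
    simp only [Prod.fst_add, Prod.smul_fst, smul_eq_mul] <;> nlinarith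

theorem mem_interior_diamond {z : Spacetime} :
    z ∈ interior diamond ↔ ‖z.2‖ < z.1 + 1 ∧ ‖z.2‖ < 1 - z.1 := by
  constructor
  · intro hz
    have exists_shift (c : ℝ) : ∃ s : ℝ, 0 < s ∧ ((z.1 + c * s, z.2) : Spacetime) ∈ diamond := by
      have hcont : Continuous fun s : ℝ => ((z.1 + c * s, z.2) : Spacetime) := by fun_prop
      have htendsto : Filter.Tendsto (fun s : ℝ => ((z.1 + c * s, z.2) : Spacetime))
          (𝓝[>] 0) (𝓝 z) := by
        simpa using (hcont.tendsto 0).mono_left nhdsWithin_le_nhds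
      obtain ⟨s, hs, hpos⟩ :=
        ((htendsto.eventually (mem_interior_iff_mem_nhds.1 hz)).and self_mem_nhdsWithin).exists
      exact ⟨s, hpos, hs⟩
    obtain ⟨s, hs, hlower, -⟩ := exists_shift (-1)
    obtain ⟨s', hs', -, hupper⟩ := exists_shift 1
    simp only at hlower hupper
    constructor <;> linarith
  · have hopen : IsOpen {z : Spacetime | ‖z.2‖ < z.1 + 1 ∧ ‖z.2‖ < 1 - z.1} :=
      (isOpen_lt (f := fun z : Spacetime => ‖z.2‖) (g := fun z => z.1 + 1)
        (by fun_prop) (by fun_prop)).inter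
      (isOpen_lt (f := fun z : Spacetime => ‖z.2‖) (g := fun z => 1 - z.1)
        (by fun_prop) (by fun_prop))
    have hsub : {z : Spacetime | ‖z.2‖ < z.1 + 1 ∧ ‖z.2‖ < 1 - z.1} ⊆ diamond :=
      fun y hy => ⟨hy.1.le, hy.2.le⟩
    exact fun hz => interior_maximal hsub hopen hz

theorem zero_mem_interior_diamond : (0 : Spacetime) ∈ interior diamond := by
  simp [mem_interior_diamond]

theorem uniqueDiffOn_diamond : UniqueDiffOn ℝ diamond :=
  uniqueDiffOn_convex convex_diamond ⟨0, zero_mem_interior_diamond⟩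

theorem closure_interior_diamond : closure (interior diamond) = diamond := by
  rw [convex_diamond.closure_interior_eq_closure_of_nonempty_interior
    ⟨0, zero_mem_interior_diamond⟩, isClosed_diamond.closure_eq]

theorem mem_interior_diamond_of_notMem_lowerBdry {z : Spacetime} (hz : z ∈ diamond)
    (hlower : z ∉ lowerBdry) (hupper : ‖z.2‖ < 1 - z.1) : z ∈ interior diamond :=
  mem_interior_diamond.2 ⟨lt_of_le_of_ne hz.1 fun h => hlower ⟨hz, h⟩, hupper⟩

/-! ### Partial derivatives and divergence -/

section PartialDerivatives

variable {F : Type*} [NormedAddCommGroup F] [NormedSpace ℝ F]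
  {𝔸 : Type*} [NormedRing 𝔸] [NormedAlgebra ℝ 𝔸]

/-- The partial derivative `∂_μ f` on space-time. -/
def pd (μ : Fin 4) (f : Spacetime → F) (z : Spacetime) : F :=
  fderiv ℝ f z (e μ)

theorem contDiffOn_pd {Ω : Set Spacetime} (hΩ : IsOpen Ω) {f : Spacetime → F} {m n : WithTop ℕ∞}
    (hf : ContDiffOn ℝ n f Ω) (hmn : m + 1 ≤ n) (μ : Fin 4) : ContDiffOn ℝ m (pd μ f) Ω :=
  (hf.fderiv_of_isOpen hΩ hmn).clm_apply contDiffOn_const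

theorem pd_congr {μ : Fin 4} {f f' : Spacetime → F} {z : Spacetime} (h : f =ᶠ[𝓝 z] f') :
    pd μ f z = pd μ f' z := by
  rw [pd, pd, h.fderiv_eq]

theorem pd_clm_comp {F' : Type*} [NormedAddCommGroup F'] [NormedSpace ℝ F'] (L : F →L[ℝ] F')
    (μ : Fin 4) {f : Spacetime → F} {z : Spacetime} (hf : DifferentiableAt ℝ f z) :
    pd μ (fun y => L (f y)) z = L (pd μ f z) := by
  have hcomp : HasFDerivAt (fun y => L (f y)) (L.comp (fderiv ℝ f z)) z :=
    L.hasFDerivAt.comp z hf.hasFDerivAt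
  rw [pd, pd, hcomp.fderiv, ContinuousLinearMap.comp_apply]

theorem pd_const (μ : Fin 4) (c : F) (z : Spacetime) : pd μ (fun _ => c) z = 0 := by
  rw [pd, fderiv_fun_const, Pi.zero_apply, _root_.zero_apply]

theorem pd_add (μ : Fin 4) {f h : Spacetime → F} {z : Spacetime} (hf : DifferentiableAt ℝ f z)
    (hh : DifferentiableAt ℝ h z) : pd μ (fun y => f y + h y) z = pd μ f z + pd μ h z := by
  rw [pd, fderiv_fun_add hf hh, _root_.add_apply, pd, pd]

theorem pd_sub (μ : Fin 4) {f h : Spacetime → F} {z : Spacetime} (hf : DifferentiableAt ℝ f z)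
    (hh : DifferentiableAt ℝ h z) : pd μ (fun y => f y - h y) z = pd μ f z - pd μ h z := by
  rw [pd, fderiv_fun_sub hf hh, _root_.sub_apply, pd, pd]

theorem pd_smul (μ : Fin 4) {ψ : Spacetime → ℝ} {f : Spacetime → F} {z : Spacetime}
    (hψ : DifferentiableAt ℝ ψ z) (hf : DifferentiableAt ℝ f z) :
    pd μ (fun y => ψ y • f y) z = ψ z • pd μ f z + pd μ ψ z • f z := by
  simp [pd, fderiv_fun_smul hψ hf]

theorem pd_mul (μ : Fin 4) {f h : Spacetime → 𝔸} {z : Spacetime} (hf : DifferentiableAt ℝ f z)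
    (hh : DifferentiableAt ℝ h z) :
    pd μ (fun y => f y * h y) z = pd μ f z * h z + f z * pd μ h z := by
  rw [pd, fderiv_fun_mul' hf hh, add_comm]
  rfl

theorem pd_lie (μ : Fin 4) {f h : Spacetime → 𝔸} {z : Spacetime} (hf : DifferentiableAt ℝ f z)
    (hh : DifferentiableAt ℝ h z) :
    pd μ (fun y => ⁅f y, h y⁆) z = ⁅pd μ f z, h z⁆ + ⁅f z, pd μ h z⁆ := by
  simp only [Ring.lie_def]
  rw [pd_sub μ (hf.fun_mul hh) (hh.fun_mul hf), pd_mul μ hf hh, pd_mul μ hh hf]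
  abel

theorem pd_comm {f : Spacetime → F} {z : Spacetime} (hf : ContDiffAt ℝ 2 f z) (μ ν : Fin 4) :
    pd μ (pd ν f) z = pd ν (pd μ f) z := by
  have hsymm : IsSymmSndFDerivAt ℝ f z := hf.isSymmSndFDerivAt (by simp)
  have hdiff : DifferentiableAt ℝ (fderiv ℝ f) z :=
    (hf.fderiv_right (m := 1) (by norm_num)).differentiableAt one_ne_zero
  have hsnd (μ ν : Fin 4) : pd μ (pd ν f) z = fderiv ℝ (fderiv ℝ f) z (e μ) (e ν) :=
    pd_clm_comp (ContinuousLinearMap.apply ℝ F (e ν)) μ hdiff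
  rw [hsnd, hsnd, hsymm.eq]

theorem sum_dx_smul_e (v : Spacetime) : ∑ μ, dx μ v • e μ = v := by
  refine Prod.ext ?_ (PiLp.ext fun j => ?_)
  · simp [Fin.sum_univ_succ, dx, e]
  · fin_cases j <;> simp [Fin.sum_univ_succ, dx, e]

/-- The divergence `∑_μ ∂_μ J^μ` of a vector field on space-time. -/
def divergence (J : Spacetime → Spacetime) (z : Spacetime) : ℝ :=
  ∑ μ, dx μ (pd μ J z)

theorem divergence_congr {J J' : Spacetime → Spacetime} {z : Spacetime} (h : J =ᶠ[𝓝 z] J') :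
    divergence J z = divergence J' z := by
  simp only [divergence, pd_congr h]

theorem divergence_smul {ψ : Spacetime → ℝ} {J : Spacetime → Spacetime} {z : Spacetime}
    (hψ : DifferentiableAt ℝ ψ z) (hJ : DifferentiableAt ℝ J z) :
    divergence (fun y => ψ y • J y) z = fderiv ℝ ψ z (J z) + ψ z * divergence J z := by
  have hdir : fderiv ℝ ψ z (J z) = ∑ μ, dx μ (J z) * pd μ ψ z := by
    conv_lhs => rw [← sum_dx_smul_e (J z)]
    simp only [map_sum, map_smul, smul_eq_mul, pd]
  simp only [divergence, pd_smul _ hψ hJ, map_add, map_smul, smul_eq_mul, hdir,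
    Finset.sum_add_distrib, Finset.mul_sum]
  rw [add_comm]
  simp only [mul_comm]

open MeasureTheory in
theorem integral_fderiv_apply_eq_zero {E : Type*} [NormedAddCommGroup E] [NormedSpace ℝ E]
    [FiniteDimensional ℝ E] [MeasurableSpace E] [BorelSpace E] (m : Measure E)
    [m.IsAddHaarMeasure] {f : E → ℝ} (hf : ContDiff ℝ 1 f) (hc : HasCompactSupport f) (v : E) :
    ∫ z, fderiv ℝ f z v ∂m = 0 := by
  have hint : Integrable f m := hf.continuous.integrable_of_hasCompactSupport hc
  have hint' : Integrable (fun z => fderiv ℝ f z v) m :=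
    ((hf.continuous_fderiv one_ne_zero).clm_apply continuous_const).integrable_of_hasCompactSupport
      (hc.fderiv_apply ℝ v)
  simpa using integral_mul_fderiv_eq_neg_fderiv_mul_of_integrable (μ := m)
    (f := fun _ : E => (1 : ℝ)) (g := f) (v := v) (by simp) (by simpa using hint')
    (by simpa using hint) (by intros; fun_prop) (fun z _ => hf.differentiable one_ne_zero z)

end PartialDerivatives

/-! ### Causal currents -/

section Currents

open MeasureTheory
open scoped RealInnerProductSpace

instance : (volume : Measure Spacetime).IsAddHaarMeasure :=
  inferInstanceAs ((volume : Measure ℝ).prod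
    (volume : Measure (EuclideanSpace ℝ (Fin 3)))).IsAddHaarMeasure

theorem integrable_divergence {X : Spacetime → Spacetime} (hX : ContDiff ℝ 1 X)
    (hc : HasCompactSupport X) : Integrable (divergence X) := by
  refine integrable_finsetSum _ fun μ _ => ?_
  refine Continuous.integrable_of_hasCompactSupport ?_ ?_
  · exact (dx μ).continuous.comp
      ((hX.continuous_fderiv one_ne_zero).clm_apply continuous_const)
  · exact (hc.fderiv_apply ℝ (e μ)).comp_left (map_zero (dx μ))

theorem integral_divergence_eq_zero {X : Spacetime → Spacetime} (hX : ContDiff ℝ 1 X)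
    (hc : HasCompactSupport X) : ∫ z, divergence X z = 0 := by
  have hcoord (μ : Fin 4) (z : Spacetime) :
      dx μ (pd μ X z) = fderiv ℝ (fun y => dx μ (X y)) z (e μ) :=
    (pd_clm_comp (dx μ) μ (hX.differentiable one_ne_zero z)).symm
  have hsmooth (μ : Fin 4) : ContDiff ℝ 1 fun y => dx μ (X y) := (dx μ).contDiff.comp hX
  have hsupp (μ : Fin 4) : HasCompactSupport fun y => dx μ (X y) := hc.comp_left (map_zero (dx μ))
  simp only [divergence, hcoord]
  rw [integral_finsetSum _ fun μ _ => (((hsmooth μ).continuous_fderiv one_ne_zero).clm_apply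
    continuous_const).integrable_of_hasCompactSupport ((hsupp μ).fderiv_apply ℝ _)]
  exact Finset.sum_eq_zero fun μ _ => integral_fderiv_apply_eq_zero volume (hsmooth μ) (hsupp μ) _

theorem fst_eq_zero_of_divergence_le_neg {X : Spacetime → Spacetime} (hX : ContDiff ℝ 1 X)
    (hc : HasCompactSupport X) (hnonneg : ∀ z, 0 ≤ (X z).1)
    (hdiv : ∀ z, divergence X z ≤ -(X z).1) (z : Spacetime) : (X z).1 = 0 := by
  have hcont : Continuous fun z => (X z).1 := continuous_fst.comp hX.continuous
  have hsupp : HasCompactSupport fun z => (X z).1 := hc.comp_left (g := Prod.fst) rfl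
  have hle : ∫ z, (X z).1 ≤ -∫ z, divergence X z := by
    rw [← integral_neg]
    exact integral_mono (hcont.integrable_of_hasCompactSupport hsupp)
      (integrable_divergence hX hc).neg fun z => le_neg_of_le_neg (hdiv z)
  rw [integral_divergence_eq_zero hX hc, neg_zero] at hle
  by_contra hne
  exact hle.not_gt (hcont.integral_pos_of_hasCompactSupport_nonneg_nonzero hsupp hnonneg hne)

/-- A smoothing of `1 - t - |x|`, positive exactly below a spacelike hyperboloid that lies in the
past of the point `(1, 0)`. -/
def upperGap (η : ℝ) (z : Spacetime) : ℝ :=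
  1 - z.1 - √(η ^ 2 + ‖z.2‖ ^ 2)

theorem contDiff_upperGap {η : ℝ} (hη : 0 < η) : ContDiff ℝ 1 (upperGap η) :=
  (contDiff_const.sub contDiff_fst).sub
    ((contDiff_const.add ((contDiff_norm_sq ℝ).comp contDiff_snd)).sqrt fun z =>
      (add_pos_of_pos_of_nonneg (pow_pos hη 2) (sq_nonneg ‖z.2‖)).ne')

theorem fderiv_upperGap {η : ℝ} (hη : 0 < η) (z v : Spacetime) :
    fderiv ℝ (upperGap η) z v = -v.1 - ⟪z.2, v.2⟫ / √(η ^ 2 + ‖z.2‖ ^ 2) := by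
  have hpos : 0 < η ^ 2 + ‖z.2‖ ^ 2 := by positivity
  have hnorm_sq : HasFDerivAt (fun y : Spacetime => ‖y.2‖ ^ 2)
      (2 • (innerSL ℝ z.2).comp (ContinuousLinearMap.snd ℝ ℝ (EuclideanSpace ℝ (Fin 3)))) z := by
    simpa using (hasFDerivAt_snd (𝕜 := ℝ) (p := z)).norm_sq
  have hgap : HasFDerivAt (upperGap η) _ z := ((hasFDerivAt_fst (𝕜 := ℝ) (p := z)).const_sub 1).sub
    ((hnorm_sq.const_add (η ^ 2)).sqrt hpos.ne')
  rw [hgap.fderiv]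
  simp only [one_div, mul_inv_rev, _root_.sub_apply, _root_.neg_apply, _root_.smul_apply,
    ContinuousLinearMap.coe_fst', ContinuousLinearMap.comp_apply, ContinuousLinearMap.coe_snd',
    coe_innerSL_apply, nsmul_eq_mul, Nat.cast_ofNat, smul_eq_mul, sub_right_inj]
  field_simp

theorem fderiv_upperGap_nonpos {η : ℝ} (hη : 0 < η) (z : Spacetime) {v : Spacetime}
    (hv : ‖v.2‖ ≤ v.1) : fderiv ℝ (upperGap η) z v ≤ 0 := by
  have hpos : 0 < √(η ^ 2 + ‖z.2‖ ^ 2) := by positivity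
  have hle : ‖z.2‖ ≤ √(η ^ 2 + ‖z.2‖ ^ 2) := Real.le_sqrt_of_sq_le (by nlinarith)
  have hinner : -⟪z.2, v.2⟫ ≤ v.1 * √(η ^ 2 + ‖z.2‖ ^ 2) := calc
    -⟪z.2, v.2⟫ ≤ ‖z.2‖ * ‖v.2‖ := (neg_le_abs _).trans (abs_real_inner_le_norm _ _)
    _ ≤ √(η ^ 2 + ‖z.2‖ ^ 2) * v.1 := mul_le_mul hle hv (norm_nonneg _) hpos.le
    _ = v.1 * √(η ^ 2 + ‖z.2‖ ^ 2) := mul_comm _ _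
  rw [fderiv_upperGap hη, sub_nonpos, neg_le, ← neg_div]
  exact (div_le_iff₀ hpos).2 hinner

theorem norm_snd_lt_of_upperGap_nonneg {η : ℝ} (hη : 0 < η) {z : Spacetime}
    (h : 0 ≤ upperGap η z) : ‖z.2‖ < 1 - z.1 :=
  (Real.lt_sqrt_of_sq_lt (by nlinarith [sq_pos_of_pos hη])).trans_le (sub_nonneg.1 h)

theorem exists_upperGap_pos {z : Spacetime} (hz : ‖z.2‖ < 1 - z.1) :
    ∃ η : ℝ, 0 < η ∧ 0 < upperGap η z := by
  have hnonneg := norm_nonneg z.2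
  refine ⟨(1 - z.1 - ‖z.2‖) / 2, by linarith, sub_pos.2 ?_⟩
  rw [Real.sqrt_lt' (by linarith)]
  nlinarith

/-- The weight of the energy estimate: a cutoff to the region `0 < upperGap η`, decreasing at
rate at least `c` along every future causal vector. -/
def energyWeight (c η : ℝ) (z : Spacetime) : ℝ :=
  Real.exp (-c * z.1) * expNegInvGlue (upperGap η z)

theorem energyWeight_nonneg (c η : ℝ) (z : Spacetime) : 0 ≤ energyWeight c η z :=
  mul_nonneg (Real.exp_pos _).le (expNegInvGlue.nonneg _)

theorem energyWeight_eq_zero {c η : ℝ} {z : Spacetime} (h : upperGap η z ≤ 0) :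
    energyWeight c η z = 0 := by
  rw [energyWeight, expNegInvGlue.zero_of_nonpos h, mul_zero]

theorem energyWeight_pos (c : ℝ) {η : ℝ} {z : Spacetime} (h : 0 < upperGap η z) :
    0 < energyWeight c η z :=
  mul_pos (Real.exp_pos _) (expNegInvGlue.pos_of_pos h)

theorem contDiff_energyWeight (c : ℝ) {η : ℝ} (hη : 0 < η) : ContDiff ℝ 1 (energyWeight c η) :=
  (Real.contDiff_exp.comp (contDiff_const.mul contDiff_fst)).mul
    ((expNegInvGlue.contDiff (n := 1)).comp (contDiff_upperGap hη))

theorem fderiv_energyWeight_le (c : ℝ) {η : ℝ} (hη : 0 < η) (z : Spacetime) {v : Spacetime}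
    (hv : ‖v.2‖ ≤ v.1) :
    fderiv ℝ (energyWeight c η) z v ≤ -c * energyWeight c η z * v.1 := by
  have hexp := ((hasFDerivAt_fst (𝕜 := ℝ) (p := z)).const_mul (-c)).exp
  have hglue : HasDerivAt expNegInvGlue _ (upperGap η z) :=
    ((expNegInvGlue.contDiff (n := 1)).differentiable one_ne_zero _).hasDerivAt
  have hgap := ((contDiff_upperGap hη).differentiable one_ne_zero z).hasFDerivAt
  have hweight : HasFDerivAt (energyWeight c η) _ z := hexp.mul (hglue.comp_hasFDerivAt z hgap)
  have hdrop : Real.exp (-c * z.1) *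
      (deriv expNegInvGlue (upperGap η z) * fderiv ℝ (upperGap η) z v) ≤ 0 :=
    mul_nonpos_of_nonneg_of_nonpos (Real.exp_pos _).le
      (mul_nonpos_of_nonneg_of_nonpos expNegInvGlue.monotone.deriv_nonneg
        (fderiv_upperGap_nonpos hη z hv))
  calc fderiv ℝ (energyWeight c η) z v
      = Real.exp (-c * z.1) * (deriv expNegInvGlue (upperGap η z) * fderiv ℝ (upperGap η) z v)
          + -c * energyWeight c η z * v.1 := by
        rw [hweight.fderiv]
        simp only [neg_mul, neg_smul, smul_neg, _root_.add_apply, _root_.smul_apply, smul_eq_mul,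
          _root_.neg_apply, ContinuousLinearMap.coe_fst', energyWeight]
        ring
    _ ≤ -c * energyWeight c η z * v.1 := by linarith

theorem divergence_energyWeight_smul_le {c η : ℝ} (hη : 0 < η) {J : Spacetime → Spacetime}
    {z : Spacetime} (hJ : DifferentiableAt ℝ J z) (hcausal : ‖(J z).2‖ ≤ (J z).1)
    (hdiv : divergence J z ≤ c * (J z).1) :
    divergence (fun y => energyWeight (c + 1) η y • J y) z ≤
      -(energyWeight (c + 1) η z * (J z).1) := by
  rw [divergence_smul ((contDiff_energyWeight (c + 1) hη).differentiable one_ne_zero z) hJ]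
  have hweight := fderiv_energyWeight_le (c + 1) hη z hcausal
  have hsource := mul_le_mul_of_nonneg_left hdiv (energyWeight_nonneg (c + 1) η z)
  linarith

theorem isCompact_upperGap_nonneg_diff (η : ℝ) {M : Set Spacetime} (hM : IsOpen M) :
    IsCompact ((diamond ∩ {y | 0 ≤ upperGap η y}) \ M) :=
  (isCompact_diamond.inter_right (isClosed_le (by fun_prop)
    (by unfold upperGap; fun_prop))).diff hM

theorem upperGap_nonneg_diff_subset_interior {η : ℝ} (hη : 0 < η) {M : Set Spacetime}
    (hlower : lowerBdry ⊆ M) :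
    (diamond ∩ {y | 0 ≤ upperGap η y}) \ M ⊆ interior diamond :=
  fun _ ⟨⟨hy, hgap⟩, hyM⟩ => mem_interior_diamond_of_notMem_lowerBdry hy
    (fun h => hyM (hlower h)) (norm_snd_lt_of_upperGap_nonneg hη hgap)

theorem contDiff_of_eq_zero_off_isCompact {E F : Type*} [NormedAddCommGroup E] [NormedSpace ℝ E]
    [NormedAddCommGroup F] [NormedSpace ℝ F] {Ω K : Set E} {m : WithTop ℕ∞} (hΩ : IsOpen Ω)
    (hK : IsCompact K) (hKΩ : K ⊆ Ω) {f : E → F} (hf : ContDiffOn ℝ m f Ω)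
    (hzero : ∀ z ∉ K, f z = 0) : ContDiff ℝ m f := by
  rw [contDiff_iff_contDiffAt]
  intro z
  by_cases hz : z ∈ Ω
  · exact hf.contDiffAt (hΩ.mem_nhds hz)
  · have hlocal : f =ᶠ[𝓝 z] fun _ => 0 :=
      Filter.eventuallyEq_of_mem (hK.isClosed.isOpen_compl.mem_nhds fun h => hz (hKΩ h)) hzero
    exact contDiffAt_const.congr_of_eventuallyEq hlocal

/-- The current is multiplied by a weight that is supported below a spacelike hyperboloid and decays
so fast along causal vectors that the divergence of the product has a sign, although its integral
vanishes. -/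
theorem fst_eq_zero_of_causal_of_divergence_le {J : Spacetime → Spacetime}
    (hJ : ContDiffOn ℝ 1 J (interior diamond))
    (hcausal : ∀ z ∈ interior diamond, ‖(J z).2‖ ≤ (J z).1)
    {M : Set Spacetime} (hM : IsOpen M) (hlower : lowerBdry ⊆ M)
    (hJM : ∀ z ∈ M ∩ interior diamond, (J z).1 = 0)
    (hdiv : ∀ K ⊆ interior diamond, IsCompact K →
      ∃ C : ℝ, ∀ z ∈ K, divergence J z ≤ C * (J z).1)
    {z : Spacetime} (hz : z ∈ interior diamond) : (J z).1 = 0 := by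
  obtain ⟨η, hη, hηz⟩ := exists_upperGap_pos (mem_interior_diamond.1 hz).2
  set K : Set Spacetime := (diamond ∩ {y | 0 ≤ upperGap η y}) \ M
  have hK : IsCompact K := isCompact_upperGap_nonneg_diff η hM
  have hKint : K ⊆ interior diamond := upperGap_nonneg_diff_subset_interior hη hlower
  obtain ⟨C, hC⟩ := hdiv K hKint hK
  set ψ := energyWeight (C + 1) η
  set X : Spacetime → Spacetime := (interior diamond).indicator fun y => ψ y • J y with hX
  have hXint {y} (hy : y ∈ interior diamond) : X y = ψ y • J y := indicator_of_mem hy _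
  have hXoff : ∀ y ∉ K, X y = 0 := fun y hyK => by
    refine indicator_apply_eq_zero.2 fun hy => ?_
    by_cases hyM : y ∈ M
    · have hfst := hJM y ⟨hyM, hy⟩
      have hJy : J y = 0 := Prod.ext hfst (norm_le_zero_iff.1 ((hcausal y hy).trans_eq hfst))
      rw [hJy, smul_zero]
    · have hgap : upperGap η y ≤ 0 := le_of_not_ge fun h => hyK ⟨⟨interior_subset hy, h⟩, hyM⟩
      simp only [ψ, energyWeight_eq_zero hgap, zero_smul]
  have hψ : ContDiff ℝ 1 ψ := contDiff_energyWeight (C + 1) hη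
  have hXsmooth : ContDiff ℝ 1 X := contDiff_of_eq_zero_off_isCompact isOpen_interior hK hKint
    ((hψ.contDiffOn.smul hJ).congr fun y hy => hXint hy) hXoff
  have hXnonneg (y) : 0 ≤ (X y).1 := by
    by_cases hy : y ∈ interior diamond
    · rw [hXint hy]
      exact mul_nonneg (energyWeight_nonneg _ _ y) ((norm_nonneg _).trans (hcausal y hy))
    · rw [hX, indicator_of_notMem hy, Prod.fst_zero]
  have hXdiv (y) : divergence X y ≤ -(X y).1 := by
    by_cases hyK : y ∈ K
    · have hnhds := isOpen_interior.mem_nhds (hKint hyK)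
      rw [divergence_congr (Filter.eventuallyEq_of_mem hnhds fun w hw => hXint hw),
        hXint (hKint hyK)]
      exact divergence_energyWeight_smul_le hη
        ((hJ.contDiffAt hnhds).differentiableAt one_ne_zero) (hcausal y (hKint hyK)) (hC y hyK)
    · rw [divergence_congr (Filter.eventuallyEq_of_mem (hK.isClosed.isOpen_compl.mem_nhds hyK)
        hXoff), hXoff y hyK]
      simp [divergence, pd]
  have hXz := fst_eq_zero_of_divergence_le_neg hXsmooth (HasCompactSupport.intro hK hXoff)
    hXnonneg hXdiv z
  rw [hXint hz, Prod.smul_fst, smul_eq_mul] at hXz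
  exact (mul_eq_zero.1 hXz).resolve_left (energyWeight_pos _ hηz).ne'

end Currents

/-! ### Symmetric hyperbolic systems -/

section SymmetricHyperbolic

open scoped RealInnerProductSpace

variable {V : Type*} [NormedAddCommGroup V] [InnerProductSpace ℝ V]

/-- The energy current of a field `u` with respect to the first-order system
`∂ₜ u = ∑ⱼ S(eⱼ) ∂ⱼ u`: the density `‖u‖² / 2` with the flux `-⟪S(eⱼ) u, u⟫ / 2`. -/
def energyCurrent (S : EuclideanSpace ℝ (Fin 3) →L[ℝ] V →L[ℝ] V) (u : Spacetime → V)
    (z : Spacetime) : Spacetime :=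
  (2⁻¹ * ⟪u z, u z⟫,
    WithLp.toLp 2 fun j => -(2⁻¹ * ⟪S (EuclideanSpace.single j 1) (u z), u z⟫))

variable {S : EuclideanSpace ℝ (Fin 3) →L[ℝ] V →L[ℝ] V} {u : Spacetime → V}

theorem norm_snd_energyCurrent_le (hS : ‖S‖ ≤ 1) (u : Spacetime → V) (z : Spacetime) :
    ‖(energyCurrent S u z).2‖ ≤ (energyCurrent S u z).1 := by
  set p := (energyCurrent S u z).2
  have hpairing : ‖p‖ ^ 2 = -(2⁻¹ * ⟪S p (u z), u z⟫) := by
    conv_rhs => rw [← (EuclideanSpace.basisFun (Fin 3) ℝ).sum_repr p]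
    simp only [EuclideanSpace.norm_sq_eq, Real.norm_eq_abs, sq_abs, map_sum, map_smul,
      sum_apply, _root_.smul_apply, sum_inner, real_inner_smul_left, Finset.mul_sum,
      ← Finset.sum_neg_distrib, EuclideanSpace.basisFun_repr, EuclideanSpace.basisFun_apply]
    refine Finset.sum_congr rfl fun j _ => ?_
    have hpj : p j = -(2⁻¹ * ⟪S (EuclideanSpace.single j 1) (u z), u z⟫) := rfl
    rw [sq, mul_left_comm, ← mul_neg, ← hpj]
  have hbound : |⟪S p (u z), u z⟫| ≤ ‖p‖ * ⟪u z, u z⟫ := calc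
    |⟪S p (u z), u z⟫| ≤ ‖S p (u z)‖ * ‖u z‖ := abs_real_inner_le_norm _ _
    _ ≤ (1 * ‖p‖ * ‖u z‖) * ‖u z‖ := by
      gcongr
      exact (S.le_opNorm₂ p (u z)).trans (by gcongr)
    _ = ‖p‖ * ⟪u z, u z⟫ := by rw [real_inner_self_eq_norm_sq]; ring
  have hsq : ‖p‖ * ‖p‖ ≤ ‖p‖ * (energyCurrent S u z).1 := by
    rw [← sq, hpairing, energyCurrent]
    linarith [neg_le_abs ⟪S p (u z), u z⟫]
  rcases (norm_nonneg p).eq_or_lt with hzero | hpos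
  · rw [← hzero]
    exact mul_nonneg (by norm_num) real_inner_self_nonneg
  · exact le_of_mul_le_mul_left hsq hpos

theorem contDiffOn_energyCurrent {Ω : Set Spacetime} (hu : ContDiffOn ℝ 1 u Ω) :
    ContDiffOn ℝ 1 (energyCurrent S u) Ω :=
  (contDiffOn_const.mul (hu.inner ℝ hu)).prodMk <| contDiffOn_euclidean.2 fun _ =>
    (contDiffOn_const.mul (((S _).contDiff.comp_contDiffOn hu).inner ℝ hu)).neg

theorem divergence_energyCurrent (hS : ∀ ν x y, ⟪S ν x, y⟫ = ⟪x, S ν y⟫) {z : Spacetime}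
    (hu : DifferentiableAt ℝ u z) (hJ : DifferentiableAt ℝ (energyCurrent S u) z) :
    divergence (energyCurrent S u) z =
      ⟪u z, pd 0 u z - ∑ j : Fin 3, S (EuclideanSpace.single j 1) (pd j.succ u z)⟫ := by
  have htime : dx 0 (pd 0 (energyCurrent S u) z) = ⟪u z, pd 0 u z⟫ := by
    rw [← pd_clm_comp _ _ hJ]
    change fderiv ℝ (fun y => 2⁻¹ * ⟪u y, u y⟫) z (e 0) = _
    rw [fderiv_const_mul (hu.inner ℝ hu), _root_.smul_apply, fderiv_inner_apply ℝ hu hu,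
      real_inner_comm (u z), smul_eq_mul, pd]
    ring
  have hspace (j : Fin 3) : dx j.succ (pd j.succ (energyCurrent S u) z) =
      -⟪u z, S (EuclideanSpace.single j 1) (pd j.succ u z)⟫ := by
    set T := S (EuclideanSpace.single j 1)
    have hTu : DifferentiableAt ℝ (fun y => T (u y)) z := T.differentiableAt.comp z hu
    rw [← pd_clm_comp _ _ hJ]
    change fderiv ℝ (fun y => -(2⁻¹ * ⟪T (u y), u y⟫)) z (e j.succ) = _
    rw [fderiv_fun_neg, fderiv_const_mul (hTu.inner ℝ hu), _root_.neg_apply,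
      _root_.smul_apply, fderiv_inner_apply ℝ hTu hu]
    change -(2⁻¹ * (⟪T (u z), pd j.succ u z⟫ + ⟪pd j.succ (fun y => T (u y)) z, u z⟫)) = _
    rw [pd_clm_comp T _ hu, hS, real_inner_comm (u z)]
    ring
  rw [divergence, Fin.sum_univ_succ, htime]
  rw [inner_sub_right, inner_sum, Finset.sum_congr rfl fun j _ => hspace j,
    Finset.sum_neg_distrib, sub_eq_add_neg]

theorem eq_zero_of_symmetricHyperbolic (hS : ∀ ν x y, ⟪S ν x, y⟫ = ⟪x, S ν y⟫) (hS1 : ‖S‖ ≤ 1)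
    (hu : ContDiffOn ℝ 1 u (interior diamond)) {M : Set Spacetime} (hM : IsOpen M)
    (hlower : lowerBdry ⊆ M) (huM : ∀ z ∈ M ∩ interior diamond, u z = 0)
    (hsystem : ∀ K ⊆ interior diamond, IsCompact K → ∃ C : ℝ, ∀ z ∈ K,
      ‖pd 0 u z - ∑ j : Fin 3, S (EuclideanSpace.single j 1) (pd j.succ u z)‖ ≤ C * ‖u z‖)
    {z : Spacetime} (hz : z ∈ interior diamond) : u z = 0 := by
  have hJ : ContDiffOn ℝ 1 (energyCurrent S u) (interior diamond) := contDiffOn_energyCurrent hu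
  have hdensity : (energyCurrent S u z).1 = 0 :=
    fst_eq_zero_of_causal_of_divergence_le hJ (fun y _ => norm_snd_energyCurrent_le hS1 u y) hM
      hlower (fun y hy => by simp [energyCurrent, huM y hy]) (fun K hK hKc => by
        obtain ⟨C, hC⟩ := hsystem K hK hKc
        refine ⟨2 * C, fun y hy => ?_⟩
        have hnhds := isOpen_interior.mem_nhds (hK hy)
        rw [divergence_energyCurrent hS ((hu.contDiffAt hnhds).differentiableAt one_ne_zero)
          ((hJ.contDiffAt hnhds).differentiableAt one_ne_zero)]
        calc ⟪u y, _⟫ ≤ ‖u y‖ * ‖_‖ := real_inner_le_norm _ _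
          _ ≤ ‖u y‖ * (C * ‖u y‖) := mul_le_mul_of_nonneg_left (hC y hy) (norm_nonneg _)
          _ = 2 * C * (energyCurrent S u y).1 := by
            simp only [energyCurrent, real_inner_self_eq_norm_sq]
            ring) hz
  simpa [energyCurrent] using hdensity

theorem eq_zero_of_symmetricHyperbolic_conj {F : Type*} [NormedAddCommGroup F] [NormedSpace ℝ F]
    (T : F ≃L[ℝ] V) (hS : ∀ ν x y, ⟪S ν x, y⟫ = ⟪x, S ν y⟫) (hS1 : ‖S‖ ≤ 1)
    {w f : Spacetime → F} (hw : ContDiffOn ℝ 1 w (interior diamond)) {M : Set Spacetime}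
    (hM : IsOpen M) (hlower : lowerBdry ⊆ M) (hwM : ∀ z ∈ M ∩ interior diamond, w z = 0)
    (hsystem : ∀ z ∈ interior diamond, pd 0 (fun y => T (w y)) z - ∑ j : Fin 3,
      S (EuclideanSpace.single j 1) (pd j.succ (fun y => T (w y)) z) = T (f z))
    (hest : ∀ K ⊆ interior diamond, IsCompact K → ∃ C : ℝ, ∀ z ∈ K, ‖f z‖ ≤ C * ‖w z‖)
    {z : Spacetime} (hz : z ∈ interior diamond) : w z = 0 := by
  refine T.map_eq_zero_iff.1 (eq_zero_of_symmetricHyperbolic hS hS1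
    (u := fun y => T (w y)) (T.contDiff.comp_contDiffOn hw) hM hlower
    (fun y hy => T.map_eq_zero_iff.2 (hwM y hy)) (fun K hK hKc => ?_) hz)
  obtain ⟨C, hC⟩ := hest K hK hKc
  refine ⟨‖T.toContinuousLinearMap‖ * (|C| * ‖T.symm.toContinuousLinearMap‖), fun y hy => ?_⟩
  rw [hsystem y (hK hy)]
  calc ‖T (f y)‖
      ≤ ‖T.toContinuousLinearMap‖ * ‖f y‖ := T.toContinuousLinearMap.le_opNorm _
    _ ≤ ‖T.toContinuousLinearMap‖ * (|C| * ‖w y‖) := by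
      gcongr
      exact (hC y hy).trans (by gcongr; exact le_abs_self C)
    _ ≤ ‖T.toContinuousLinearMap‖ * (|C| * (‖T.symm.toContinuousLinearMap‖ * ‖T (w y)‖)) := by
      gcongr
      simpa using T.symm.toContinuousLinearMap.le_opNorm (T (w y))
    _ = _ := by ring

end SymmetricHyperbolic

/-! ### Systems of Maxwell type -/

section Maxwell

/-- Vectors of space with coefficients in `W`, with the euclidean norm. -/
abbrev Vec3 (W : Type*) : Type _ := PiLp 2 fun _ : Fin 3 => W

open scoped RealInnerProductSpace

section Symbol

variable {W : Type*} [NormedAddCommGroup W] [InnerProductSpace ℝ W]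

/-- The cross product `ν × x` of a real vector with a `W`-valued vector. The indices `k`, `k + 1`,
`k + 2` in `Fin 3` are cyclic. -/
def cross : EuclideanSpace ℝ (Fin 3) →ₗ[ℝ] Vec3 W →ₗ[ℝ] Vec3 W :=
  LinearMap.mk₂ ℝ (fun ν x => WithLp.toLp 2 fun k => ν (k + 1) • x (k + 2) - ν (k + 2) • x (k + 1))
    (fun ν ν' x => by ext k; simp only [PiLp.add_apply]; module)
    (fun c ν x => by ext k; simp only [PiLp.smul_apply, smul_eq_mul]; module)
    (fun ν x x' => by ext k; simp only [PiLp.add_apply]; module)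
    (fun c ν x => by ext k; simp only [PiLp.smul_apply]; module)

theorem cross_apply (ν : EuclideanSpace ℝ (Fin 3)) (x : Vec3 W) (k : Fin 3) :
    cross ν x k = ν (k + 1) • x (k + 2) - ν (k + 2) • x (k + 1) :=
  rfl

theorem inner_cross_left (ν : EuclideanSpace ℝ (Fin 3)) (x y : Vec3 W) :
    ⟪cross ν x, y⟫ = -⟪x, cross ν y⟫ := by
  simp only [PiLp.inner_apply, cross_apply, Fin.sum_univ_three, inner_sub_left, inner_sub_right,
    real_inner_smul_left, real_inner_smul_right, Fin.isValue, Fin.reduceAdd, zero_add]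
  ring

theorem norm_cross_sq (ν : EuclideanSpace ℝ (Fin 3)) (x : Vec3 W) :
    ‖cross ν x‖ ^ 2 = ‖ν‖ ^ 2 * ‖x‖ ^ 2 - ‖∑ k, ν k • x k‖ ^ 2 := by
  simp only [← real_inner_self_eq_norm_sq, PiLp.inner_apply, cross_apply, Fin.sum_univ_three,
    inner_sub_left, inner_sub_right, inner_add_left, inner_add_right, real_inner_smul_left,
    real_inner_smul_right, Fin.isValue, Fin.reduceAdd, zero_add, real_inner_comm (x 0) (x 1),
    real_inner_comm (x 0) (x 2), real_inner_comm (x 1) (x 2)]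
  simp only [RCLike.inner_apply, conj_trivial]
  ring

theorem norm_cross_sq_le (ν : EuclideanSpace ℝ (Fin 3)) (x : Vec3 W) :
    ‖cross ν x‖ ^ 2 ≤ ‖ν‖ ^ 2 * ‖x‖ ^ 2 := by
  rw [norm_cross_sq]
  linarith [sq_nonneg ‖∑ k, ν k • x k‖]

/-- The symbol `S(ν) (a, E, H) = (0, -ν × H, ν × E)` of the system `∂ₜ a = 0`, `∂ₜ E = -curl H`,
`∂ₜ H = curl E`, as a bilinear map. -/
def maxwellBilin : EuclideanSpace ℝ (Fin 3) →ₗ[ℝ] Vec3 (Vec3 W) →ₗ[ℝ] Vec3 (Vec3 W) :=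
  LinearMap.mk₂ ℝ (fun ν u => WithLp.toLp 2 ![0, -cross ν (u 2), cross ν (u 1)])
    (fun ν ν' u => by
      ext i : 1
      fin_cases i
      exacts [(add_zero 0).symm, by simp only [map_add, LinearMap.add_apply, neg_add]; rfl,
        LinearMap.map_add₂ cross ν ν' (u 1)])
    (fun c ν u => by
      ext i : 1
      fin_cases i
      exacts [(smul_zero c).symm, by simp only [map_smul, LinearMap.smul_apply, ← smul_neg]; rfl,
        LinearMap.map_smul₂ cross c ν (u 1)])
    (fun ν u u' => by
      ext i : 1
      fin_cases i
      exacts [(add_zero 0).symm, by simp only [PiLp.add_apply, map_add, neg_add]; rfl,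
        map_add (cross ν) (u 1) (u' 1)])
    (fun c ν u => by
      ext i : 1
      fin_cases i
      exacts [(smul_zero c).symm, by simp only [PiLp.smul_apply, map_smul, ← smul_neg]; rfl,
        map_smul (cross ν) c (u 1)])

theorem maxwellBilin_apply (ν : EuclideanSpace ℝ (Fin 3)) (u : Vec3 (Vec3 W)) :
    maxwellBilin ν u = WithLp.toLp 2 ![0, -cross ν (u 2), cross ν (u 1)] :=
  rfl

theorem norm_maxwellBilin_le (ν : EuclideanSpace ℝ (Fin 3)) (u : Vec3 (Vec3 W)) :
    ‖maxwellBilin ν u‖ ≤ ‖ν‖ * ‖u‖ := by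
  refine le_of_sq_le_sq ?_ (by positivity)
  have hnorm (v : Vec3 (Vec3 W)) : ‖v‖ ^ 2 = ‖v 0‖ ^ 2 + ‖v 1‖ ^ 2 + ‖v 2‖ ^ 2 := by
    rw [PiLp.norm_sq_eq_of_L2, Fin.sum_univ_three]
  rw [mul_pow, hnorm u, hnorm, maxwellBilin_apply]
  simp only [Matrix.cons_val, norm_zero, norm_neg]
  nlinarith [norm_cross_sq_le ν (u 1), norm_cross_sq_le ν (u 2), sq_nonneg (‖ν‖ * ‖u 0‖)]

/-- `maxwellBilin` as a continuous bilinear map. -/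
def maxwellSymbol : EuclideanSpace ℝ (Fin 3) →L[ℝ] Vec3 (Vec3 W) →L[ℝ] Vec3 (Vec3 W) :=
  maxwellBilin.mkContinuous₂ 1 fun ν u => by simpa using norm_maxwellBilin_le ν u

theorem maxwellSymbol_apply (ν : EuclideanSpace ℝ (Fin 3))
    (u : Vec3 (Vec3 W)) :
    maxwellSymbol ν u = WithLp.toLp 2 ![0, -cross ν (u 2), cross ν (u 1)] :=
  rfl

set_option maxSynthPendingDepth 3 in
theorem norm_maxwellSymbol_le : ‖maxwellSymbol (W := W)‖ ≤ 1 :=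
  LinearMap.mkContinuous₂_norm_le _ zero_le_one _

theorem inner_maxwellSymbol_left (ν : EuclideanSpace ℝ (Fin 3))
    (u v : Vec3 (Vec3 W)) :
    ⟪maxwellSymbol ν u, v⟫ = ⟪u, maxwellSymbol ν v⟫ := by
  simp only [maxwellSymbol_apply, PiLp.inner_apply _ v, PiLp.inner_apply u, Fin.sum_univ_three,
    Matrix.cons_val, inner_zero_left, inner_zero_right, inner_neg_left, inner_neg_right,
    inner_cross_left]
  ring

end Symbol

section Uniqueness

variable {W : Type*} [NormedAddCommGroup W] [NormedSpace ℝ W]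

/-- The curl of a field on space. The indices `k`, `k + 1`, `k + 2` in `Fin 3` are cyclic. -/
def curl (f : Spacetime → Fin 3 → W) (z : Spacetime) (k : Fin 3) : W :=
  pd (k + 1).succ (f · (k + 2)) z - pd (k + 2).succ (f · (k + 1)) z

/-- The operator `(a, E, H) ↦ (∂ₜ a, ∂ₜ E + curl H, ∂ₜ H - curl E)`, where the triple `(a, E, H)`
is encoded as `w` with `a = w · 0`, `E = w · 1` and `H = w · 2`. -/
def maxwellOperator (w : Spacetime → Fin 3 → Fin 3 → W) (z : Spacetime) : Fin 3 → Fin 3 → W :=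
  ![fun k => pd 0 (w · 0 k) z,
    fun k => pd 0 (w · 1 k) z + curl (w · 2) z k,
    fun k => pd 0 (w · 2 k) z - curl (w · 1) z k]

theorem pd_apply_apply {ι κ : Type*} [Fintype ι] [Fintype κ] (μ : Fin 4)
    {f : Spacetime → ι → κ → W} {z : Spacetime}
    (hf : DifferentiableAt ℝ f z) (i : ι) (k : κ) :
    pd μ f z i k = pd μ (fun y => f y i k) z :=
  (pd_clm_comp ((ContinuousLinearMap.proj (R := ℝ) (φ := fun _ : κ => W) k).comp
    (ContinuousLinearMap.proj (φ := fun _ : ι => κ → W) i)) μ hf).symm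

theorem maxwellOperator_sub {w w' : Spacetime → Fin 3 → Fin 3 → W} {z : Spacetime}
    (hw : DifferentiableAt ℝ w z) (hw' : DifferentiableAt ℝ w' z) :
    maxwellOperator (fun y => w y - w' y) z = maxwellOperator w z - maxwellOperator w' z := by
  have hpd (μ : Fin 4) (i k : Fin 3) : pd μ (fun y => w y i k - w' y i k) z =
      pd μ (fun y => w y i k) z - pd μ (fun y => w' y i k) z := by
    refine (pd_apply_apply μ (hw.fun_sub hw') i k).symm.trans ?_
    rw [pd_sub μ hw hw', Pi.sub_apply, Pi.sub_apply,
      pd_apply_apply μ hw, pd_apply_apply μ hw']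
  ext i k
  fin_cases i <;> simp only [maxwellOperator, curl, hpd, Pi.sub_apply, Fin.zero_eta, Fin.mk_one,
    Fin.reduceFinMk, Matrix.cons_val] <;> abel

variable [FiniteDimensional ℝ W]

variable (W) in
/-- A euclidean structure on the triples `(a, E, H)`. -/
def tripleEquiv : (Fin 3 → Fin 3 → W) ≃L[ℝ]
    Vec3 (Vec3 (EuclideanSpace ℝ (Fin (Module.finrank ℝ W)))) :=
  (ContinuousLinearEquiv.piCongrRight fun _ =>
    (ContinuousLinearEquiv.piCongrRight fun _ => toEuclidean).trans
      (PiLp.continuousLinearEquiv 2 ℝ _).symm).trans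
    (PiLp.continuousLinearEquiv 2 ℝ _).symm

theorem tripleEquiv_apply (w : Fin 3 → Fin 3 → W) (i k : Fin 3) :
    tripleEquiv W w i k = toEuclidean (w i k) :=
  rfl

theorem pd_sub_sum_maxwellSymbol {w : Spacetime → Fin 3 → Fin 3 → W} {z : Spacetime}
    (hw : DifferentiableAt ℝ w z) :
    pd 0 (fun y => tripleEquiv W (w y)) z -
      ∑ j : Fin 3, maxwellSymbol (EuclideanSpace.single j 1)
        (pd j.succ (fun y => tripleEquiv W (w y)) z) =
    tripleEquiv W (maxwellOperator w z) := by
  have hpd (μ : Fin 4) : pd μ (fun y => tripleEquiv W (w y)) z = tripleEquiv W (pd μ w z) :=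
    pd_clm_comp (tripleEquiv W).toContinuousLinearMap μ hw
  ext i k : 2
  simp only [hpd, maxwellSymbol_apply, PiLp.sub_apply, Fin.sum_univ_three, PiLp.add_apply,
    tripleEquiv_apply, maxwellOperator, curl, ← pd_apply_apply _ hw]
  fin_cases i <;> fin_cases k <;> simp [cross_apply, tripleEquiv_apply] <;> abel

theorem eq_zero_of_norm_maxwellOperator_le {w : Spacetime → Fin 3 → Fin 3 → W}
    (hw : ContDiffOn ℝ 1 w (interior diamond))
    {M : Set Spacetime} (hM : IsOpen M) (hlower : lowerBdry ⊆ M)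
    (hzero : ∀ z ∈ M ∩ interior diamond, w z = 0)
    (hest : ∀ K ⊆ interior diamond, IsCompact K → ∃ C : ℝ, ∀ z ∈ K,
      ‖maxwellOperator w z‖ ≤ C * ‖w z‖)
    {z : Spacetime} (hz : z ∈ interior diamond) : w z = 0 :=
  eq_zero_of_symmetricHyperbolic_conj (tripleEquiv W) inner_maxwellSymbol_left
    norm_maxwellSymbol_le hw hM hlower hzero
    (fun _ hy => pd_sub_sum_maxwellSymbol
      ((hw.contDiffAt (isOpen_interior.mem_nhds hy)).differentiableAt one_ne_zero)) hest hz

theorem eqOn_of_maxwellOperator_sub_eq {P : (Fin 3 → Fin 3 → W) → Fin 3 → Fin 3 → W}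
    (hP : LocallyLipschitz P) {w w' : Spacetime → Fin 3 → Fin 3 → W}
    (hw : ContDiffOn ℝ 1 w (interior diamond)) (hw' : ContDiffOn ℝ 1 w' (interior diamond))
    {M : Set Spacetime} (hM : IsOpen M) (hlower : lowerBdry ⊆ M)
    (hww' : EqOn w w' (M ∩ interior diamond))
    (hmaxwell : ∀ z ∈ interior diamond,
      maxwellOperator w z - P (w z) = maxwellOperator w' z - P (w' z)) :
    EqOn w w' (interior diamond) := by
  have hdiff {w : Spacetime → Fin 3 → Fin 3 → W} (hw : ContDiffOn ℝ 1 w (interior diamond))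
      {z : Spacetime} (hz : z ∈ interior diamond) : DifferentiableAt ℝ w z :=
    (hw.contDiffAt (isOpen_interior.mem_nhds hz)).differentiableAt one_ne_zero
  refine fun z hz => sub_eq_zero.1 (eq_zero_of_norm_maxwellOperator_le (hw.sub hw') hM hlower
    (fun y hy => sub_eq_zero.2 (hww' hy)) (fun K hK hKc => ?_) hz)
  have hvalues : IsCompact (w '' K ∪ w' '' K) :=
    (hKc.image_of_continuousOn (hw.continuousOn.mono hK)).union
      (hKc.image_of_continuousOn (hw'.continuousOn.mono hK))
  obtain ⟨C, hC⟩ := LocallyLipschitzOn.exists_lipschitzOnWith_of_compact hvalues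
    hP.locallyLipschitzOn
  refine ⟨C, fun y hy => ?_⟩
  rw [maxwellOperator_sub (hdiff hw (hK hy)) (hdiff hw' (hK hy)),
    sub_eq_sub_iff_sub_eq_sub.1 (hmaxwell y (hK hy)), ← dist_eq_norm, ← dist_eq_norm]
  exact hC.dist_le_mul _ (.inl ⟨y, hy, rfl⟩) _ (.inr ⟨y, hy, rfl⟩)

end Uniqueness

end Maxwell

/-! ### Connections in coordinates -/

section Connection

attribute [local instance] LieRing.ofAssociativeRing

variable {𝔸 : Type*} [NormedRing 𝔸] [NormedAlgebra ℝ 𝔸]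

/-- The covariant derivative `∇_μ f = ∂_μ f + [A_μ, f]` for a connection with components `A_μ`. -/
def covPd (A : Fin 4 → Spacetime → 𝔸) (μ : Fin 4) (f : Spacetime → 𝔸) (z : Spacetime) : 𝔸 :=
  pd μ f z + ⁅A μ z, f z⁆

/-- The components `F_{μν}` of the curvature. -/
def curvComp (A : Fin 4 → Spacetime → 𝔸) (μ ν : Fin 4) (z : Spacetime) : 𝔸 :=
  pd μ (A ν) z - pd ν (A μ) z + ⁅A μ z, A ν z⁆

/-- The components `∇^μ F_{μν}` of the covariant divergence of the curvature. -/
def divComp (A : Fin 4 → Spacetime → 𝔸) (ν : Fin 4) (z : Spacetime) : 𝔸 :=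
  ∑ μ, g μ • covPd A μ (curvComp A μ ν) z

variable {A B : Fin 4 → Spacetime → 𝔸} {Ω : Set Spacetime}

theorem curvComp_swap (A : Fin 4 → Spacetime → 𝔸) (μ ν : Fin 4) (z : Spacetime) :
    curvComp A μ ν z = -curvComp A ν μ z := by
  rw [curvComp, curvComp, ← lie_skew (A μ z)]
  abel

theorem curvComp_self (A : Fin 4 → Spacetime → 𝔸) (μ : Fin 4) (z : Spacetime) :
    curvComp A μ μ z = 0 := by
  rw [curvComp, lie_self, sub_self, add_zero]

theorem covPd_congr {μ : Fin 4} {f h : Spacetime → 𝔸} {z : Spacetime} (hfh : f =ᶠ[𝓝 z] h) :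
    covPd A μ f z = covPd A μ h z := by
  rw [covPd, covPd, pd_congr hfh, hfh.eq_of_nhds]

theorem covPd_const_smul (A : Fin 4 → Spacetime → 𝔸) (μ : Fin 4) (c : ℝ) (f : Spacetime → 𝔸)
    (z : Spacetime) : covPd A μ (fun y => c • f y) z = c • covPd A μ f z := by
  have hpd : pd μ (fun y => c • f y) z = c • pd μ f z :=
    congrArg (fun L : Spacetime → Spacetime →L[ℝ] 𝔸 => L z (e μ)) (fderiv_const_smul_field c)
  rw [covPd, covPd, hpd, smul_add, Ring.lie_def, Ring.lie_def, mul_smul_comm, smul_mul_assoc,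
    smul_sub]

theorem covPd_curvComp_self (A : Fin 4 → Spacetime → 𝔸) (μ ν : Fin 4) (z : Spacetime) :
    covPd A μ (curvComp A ν ν) z = 0 := by
  rw [covPd, funext (curvComp_self A ν), pd_const, lie_zero, add_zero]

theorem contDiffOn_curvComp (hΩ : IsOpen Ω) {m n : WithTop ℕ∞}
    (hA : ∀ μ, ContDiffOn ℝ n (A μ) Ω) (hmn : m + 1 ≤ n) (μ ν : Fin 4) :
    ContDiffOn ℝ m (curvComp A μ ν) Ω := by
  have hAm (μ : Fin 4) : ContDiffOn ℝ m (A μ) Ω := (hA μ).of_le (le_self_add.trans hmn)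
  exact ((contDiffOn_pd hΩ (hA ν) hmn μ).sub (contDiffOn_pd hΩ (hA μ) hmn ν)).add
    (((hAm μ).mul (hAm ν)).sub ((hAm ν).mul (hAm μ)))

theorem curvComp_congr {z : Spacetime} (hAB : ∀ μ, A μ =ᶠ[𝓝 z] B μ) (μ ν : Fin 4) :
    curvComp A μ ν z = curvComp B μ ν z := by
  rw [curvComp, curvComp, pd_congr (hAB ν), pd_congr (hAB μ), (hAB μ).eq_of_nhds,
    (hAB ν).eq_of_nhds]

/-! ### The Yang–Mills equation in temporal gauge -/

theorem curvComp_zero_left_of_temporal (hΩ : IsOpen Ω) (hA0 : ∀ z ∈ Ω, A 0 z = 0) (ν : Fin 4)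
    {z : Spacetime} (hz : z ∈ Ω) : curvComp A 0 ν z = pd 0 (A ν) z := by
  have hzero : A 0 =ᶠ[𝓝 z] fun _ => 0 :=
    Filter.eventually_of_mem (hΩ.mem_nhds hz) hA0
  rw [curvComp, pd_congr hzero, pd_const, hA0 z hz, zero_lie, sub_zero, add_zero]

/-- The Bianchi identity `∇₀F_{μν} + ∇_μF_{ν0} + ∇_νF_{0μ} = 0`. -/
theorem pd_zero_curvComp_of_temporal (hΩ : IsOpen Ω) (hA : ∀ μ, ContDiffOn ℝ 2 (A μ) Ω)
    (hA0 : ∀ z ∈ Ω, A 0 z = 0) (μ ν : Fin 4) {z : Spacetime} (hz : z ∈ Ω) :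
    pd 0 (curvComp A μ ν) z = covPd A μ (curvComp A 0 ν) z - covPd A ν (curvComp A 0 μ) z := by
  have hnhds := hΩ.mem_nhds hz
  have hdiff (μ : Fin 4) : DifferentiableAt ℝ (A μ) z :=
    ((hA μ).contDiffAt hnhds).differentiableAt two_ne_zero
  have hdiff_pd (μ ν : Fin 4) : DifferentiableAt ℝ (pd μ (A ν)) z :=
    ((contDiffOn_pd hΩ (m := 1) (hA ν) (by norm_num) μ).contDiffAt hnhds).differentiableAt
      one_ne_zero
  have hlie : DifferentiableAt ℝ (fun y => ⁅A μ y, A ν y⁆) z :=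
    ((hdiff μ).fun_mul (hdiff ν)).fun_sub ((hdiff ν).fun_mul (hdiff μ))
  have htemporal (μ : Fin 4) : curvComp A 0 μ =ᶠ[𝓝 z] pd 0 (A μ) :=
    Filter.eventually_of_mem hnhds fun _ hy => curvComp_zero_left_of_temporal hΩ hA0 μ hy
  calc pd 0 (curvComp A μ ν) z
      = pd 0 (pd μ (A ν)) z - pd 0 (pd ν (A μ)) z
          + (⁅pd 0 (A μ) z, A ν z⁆ + ⁅A μ z, pd 0 (A ν) z⁆) := by
        unfold curvComp
        rw [pd_add 0 ((hdiff_pd μ ν).fun_sub (hdiff_pd ν μ)) hlie,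
          pd_sub 0 (hdiff_pd μ ν) (hdiff_pd ν μ), pd_lie 0 (hdiff μ) (hdiff ν)]
    _ = _ := by
        rw [covPd, covPd, pd_congr (htemporal ν), pd_congr (htemporal μ),
          (htemporal ν).eq_of_nhds, (htemporal μ).eq_of_nhds,
          pd_comm ((hA ν).contDiffAt hnhds) μ 0, pd_comm ((hA μ).contDiffAt hnhds) ν 0,
          ← lie_skew (A ν z)]
        abel

/-- The triple `(A_k, F_{0k}, F_{k+1,k+2})` of the potential and the electric and magnetic fields,
in the encoding of `maxwellOperator`. -/
def maxwellFields (A : Fin 4 → Spacetime → 𝔸) (z : Spacetime) : Fin 3 → Fin 3 → 𝔸 :=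
  ![fun k => A k.succ z, fun k => curvComp A 0 k.succ z,
    fun k => curvComp A (k + 1).succ (k + 2).succ z]

/-- The cross product `a × f` formed with the commutator. -/
def lieCross (a f : Fin 3 → 𝔸) (k : Fin 3) : 𝔸 :=
  ⁅a (k + 1), f (k + 2)⁆ - ⁅a (k + 2), f (k + 1)⁆

/-- The self-interaction of the Yang–Mills fields `w = (a, E, H)` in temporal gauge. -/
def selfInteraction (w : Fin 3 → Fin 3 → 𝔸) : Fin 3 → Fin 3 → 𝔸 :=
  ![w 1, -lieCross (w 0) (w 2), lieCross (w 0) (w 1)]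

theorem contDiff_selfInteraction {n : WithTop ℕ∞} : ContDiff ℝ n (selfInteraction (𝔸 := 𝔸)) := by
  have hcoord (i k : Fin 3) : ContDiff ℝ n fun w : Fin 3 → Fin 3 → 𝔸 => w i k :=
    contDiff_apply_apply ℝ 𝔸 i k
  have hcross (i j k : Fin 3) :
      ContDiff ℝ n fun w : Fin 3 → Fin 3 → 𝔸 => lieCross (w i) (w j) k := by
    unfold lieCross
    simp only [Ring.lie_def]
    fun_prop
  refine contDiff_pi.2 fun i => contDiff_pi.2 fun k => ?_
  fin_cases i
  exacts [hcoord 1 k, (hcross 0 2 k).neg, hcross 0 1 k]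

theorem contDiffOn_maxwellFields (hΩ : IsOpen Ω) (hA : ∀ μ, ContDiffOn ℝ 2 (A μ) Ω) :
    ContDiffOn ℝ 1 (maxwellFields A) Ω := by
  refine contDiffOn_pi.2 fun i => contDiffOn_pi.2 fun k => ?_
  have hcurv := contDiffOn_curvComp hΩ (m := 1) hA (by norm_num)
  fin_cases i
  exacts [(hA _).of_le (by norm_num), hcurv _ _, hcurv _ _]

theorem divComp_succ_of_temporal {z : Spacetime} (hA0 : A 0 z = 0) (k : Fin 3) :
    divComp A k.succ z = covPd A (k + 2).succ (curvComp A (k + 2).succ k.succ) z -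
      covPd A (k + 1).succ (curvComp A k.succ (k + 1).succ) z - pd 0 (curvComp A 0 k.succ) z := by
  have hswap : covPd A (k + 1).succ (curvComp A (k + 1).succ k.succ) z =
      -covPd A (k + 1).succ (curvComp A k.succ (k + 1).succ) z := by
    rw [← neg_one_smul ℝ, ← covPd_const_smul, funext (curvComp_swap A (k + 1).succ k.succ)]
    simp only [neg_one_smul]
  have hcyclic (f : Fin 3 → 𝔸) : ∑ j, f j = f k + f (k + 1) + f (k + 2) := by
    rw [Fin.sum_univ_three]
    fin_cases k <;> simp only [Fin.zero_eta, Fin.mk_one, Fin.reduceFinMk, Fin.reduceAdd, zero_add]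
      <;> abel
  rw [divComp, Fin.sum_univ_succ, hcyclic]
  simp only [g, ite_true, if_neg (Fin.succ_ne_zero _), one_smul, neg_smul,
    covPd_curvComp_self, hswap]
  rw [covPd, hA0, zero_lie]
  abel

theorem maxwellOperator_maxwellFields (hΩ : IsOpen Ω) (hA : ∀ μ, ContDiffOn ℝ 2 (A μ) Ω)
    (hA0 : ∀ z ∈ Ω, A 0 z = 0) {z : Spacetime} (hz : z ∈ Ω) :
    maxwellOperator (maxwellFields A) z = selfInteraction (maxwellFields A z) -
        (![0, fun k => divComp A k.succ z, 0] : Fin 3 → Fin 3 → 𝔸) := by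
  have h3 (k : Fin 3) : k + 1 + 2 = k ∧ k + 2 + 1 = k ∧ k + 1 + 1 = k + 2 ∧ k + 2 + 2 = k + 1 := by
    decide +revert
  ext i k
  obtain ⟨h12, h21, h11, h22⟩ := h3 k
  fin_cases i
  · simp only [maxwellOperator, selfInteraction, maxwellFields, Fin.zero_eta, Pi.sub_apply,
      Matrix.cons_val, Pi.zero_apply, sub_zero, curvComp_zero_left_of_temporal hΩ hA0 k.succ hz]
  · simp only [maxwellOperator, selfInteraction, maxwellFields, curl, lieCross, Fin.mk_one,
      Pi.sub_apply, Pi.neg_apply, Matrix.cons_val, divComp_succ_of_temporal (hA0 z hz), covPd,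
      h12, h21, h11, h22]
    abel
  · simp only [maxwellOperator, selfInteraction, maxwellFields, curl, lieCross, Fin.reduceFinMk,
      Pi.sub_apply, Matrix.cons_val, Pi.zero_apply,
      pd_zero_curvComp_of_temporal hΩ hA hA0 (k + 1).succ (k + 2).succ hz, covPd]
    abel

theorem eqOn_of_divComp_eq [FiniteDimensional ℝ 𝔸]
    (hA : ∀ μ, ContDiffOn ℝ 2 (A μ) (interior diamond))
    (hB : ∀ μ, ContDiffOn ℝ 2 (B μ) (interior diamond))
    (hA0 : ∀ z ∈ interior diamond, A 0 z = 0) (hB0 : ∀ z ∈ interior diamond, B 0 z = 0)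
    {M : Set Spacetime} (hM : IsOpen M) (hlower : lowerBdry ⊆ M)
    (hAB : ∀ μ, EqOn (A μ) (B μ) (M ∩ interior diamond))
    (hdiv : ∀ k : Fin 3, EqOn (divComp A k.succ) (divComp B k.succ) (interior diamond))
    (μ : Fin 4) : EqOn (A μ) (B μ) (interior diamond) := by
  have hfields : EqOn (maxwellFields A) (maxwellFields B) (interior diamond) := by
    refine eqOn_of_maxwellOperator_sub_eq (contDiff_selfInteraction (n := 1)).locallyLipschitz
      (contDiffOn_maxwellFields isOpen_interior hA) (contDiffOn_maxwellFields isOpen_interior hB)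
      hM hlower (fun z hz => ?_) fun z hz => ?_
    · have hgerm (μ : Fin 4) : A μ =ᶠ[𝓝 z] B μ :=
        (hAB μ).eventuallyEq_of_mem ((hM.inter isOpen_interior).mem_nhds hz)
      simp only [maxwellFields, curvComp_congr hgerm, (hgerm _).eq_of_nhds]
    · rw [maxwellOperator_maxwellFields isOpen_interior hA hA0 hz,
        maxwellOperator_maxwellFields isOpen_interior hB hB0 hz, sub_sub_cancel_left,
        sub_sub_cancel_left, funext fun k => hdiv k hz]
  intro z hz
  cases μ using Fin.cases with
  | zero => rw [hA0 z hz, hB0 z hz]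
  | succ j => exact congr_fun₂ (hfields hz) 0 j

end Connection

/-! ### Gauge covariance -/

section Gauge

variable {𝔸 : Type*} [NormedRing 𝔸] [NormedAlgebra ℝ 𝔸]
  {A B : Fin 4 → Spacetime → 𝔸} {V : Spacetime → 𝔸}

theorem mul_covPd_of_gauge {μ : Fin 4} {f f' : Spacetime → 𝔸} {z : Spacetime}
    (hf : DifferentiableAt ℝ f z) (hf' : DifferentiableAt ℝ f' z) (hV : DifferentiableAt ℝ V z)
    (hgauge : V z * A μ z = pd μ V z + B μ z * V z)
    (hff' : (fun y => V y * f y) =ᶠ[𝓝 z] fun y => f' y * V y) :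
    V z * covPd A μ f z = covPd B μ f' z * V z := by
  have hleibniz : pd μ V z * f z + V z * pd μ f z = pd μ f' z * V z + f' z * pd μ V z := by
    rw [← pd_mul μ hV hf, ← pd_mul μ hf' hV, pd_congr hff']
  have hvalue : V z * f z = f' z * V z := hff'.eq_of_nhds
  calc V z * covPd A μ f z
      = V z * pd μ f z + (V z * A μ z) * f z - (V z * f z) * A μ z := by
        rw [covPd, Ring.lie_def]
        noncomm_ring
    _ = V z * pd μ f z + (pd μ V z + B μ z * V z) * f z - (f' z * V z) * A μ z := by
        rw [hgauge, hvalue]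
    _ = (pd μ V z * f z + V z * pd μ f z) + B μ z * (V z * f z) - f' z * (V z * A μ z) := by
        noncomm_ring
    _ = covPd B μ f' z * V z := by
        rw [hleibniz, hgauge, hvalue, covPd, Ring.lie_def]
        noncomm_ring

variable {Ω : Set Spacetime}

theorem mul_curvComp_of_gauge (hΩ : IsOpen Ω) (hA : ∀ μ, DifferentiableOn ℝ (A μ) Ω)
    (hB : ∀ μ, DifferentiableOn ℝ (B μ) Ω) (hV : ContDiffOn ℝ 2 V Ω)
    (hgauge : ∀ μ, ∀ z ∈ Ω, V z * A μ z = pd μ V z + B μ z * V z) (μ ν : Fin 4) {z : Spacetime}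
    (hz : z ∈ Ω) : V z * curvComp A μ ν z = curvComp B μ ν z * V z := by
  have hnhds := hΩ.mem_nhds hz
  have hdA (μ : Fin 4) : DifferentiableAt ℝ (A μ) z := (hA μ).differentiableAt hnhds
  have hdB (μ : Fin 4) : DifferentiableAt ℝ (B μ) z := (hB μ).differentiableAt hnhds
  have hdV : DifferentiableAt ℝ V z := (hV.contDiffAt hnhds).differentiableAt two_ne_zero
  have hd_pdV (μ : Fin 4) : DifferentiableAt ℝ (pd μ V) z :=
    ((contDiffOn_pd hΩ (m := 1) hV (by norm_num) μ).contDiffAt hnhds).differentiableAt one_ne_zero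
  have hpd (μ ν : Fin 4) : V z * pd μ (A ν) z =
      pd μ (pd ν V) z + pd μ (B ν) z * V z + B ν z * pd μ V z - pd μ V z * A ν z := by
    have hleibniz : pd μ (fun y => V y * A ν y) z = pd μ (fun y => pd ν V y + B ν y * V y) z :=
      pd_congr (Filter.eventually_of_mem hnhds (hgauge ν))
    rw [pd_mul μ hdV (hdA ν), pd_add μ (hd_pdV ν) ((hdB ν).fun_mul hdV),
      pd_mul μ (hdB ν) hdV] at hleibniz
    rw [eq_sub_iff_add_eq', hleibniz, add_assoc]
  calc V z * curvComp A μ ν z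
      = V z * pd μ (A ν) z - V z * pd ν (A μ) z
          + ((V z * A μ z) * A ν z - (V z * A ν z) * A μ z) := by
        rw [curvComp, Ring.lie_def]
        noncomm_ring
    _ = (pd μ (B ν) z * V z + B ν z * pd μ V z) - (pd ν (B μ) z * V z + B μ z * pd ν V z)
          + (B μ z * (V z * A ν z) - B ν z * (V z * A μ z)) := by
        rw [hpd μ ν, hpd ν μ, pd_comm (hV.contDiffAt hnhds) μ ν,
          eq_sub_of_add_eq (hgauge μ z hz).symm, eq_sub_of_add_eq (hgauge ν z hz).symm]
        noncomm_ring
    _ = curvComp B μ ν z * V z := by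
        rw [hgauge μ z hz, hgauge ν z hz, curvComp, Ring.lie_def]
        noncomm_ring

theorem mul_divComp_of_gauge (hΩ : IsOpen Ω) (hA : ∀ μ, ContDiffOn ℝ 2 (A μ) Ω)
    (hB : ∀ μ, ContDiffOn ℝ 2 (B μ) Ω) (hV : ContDiffOn ℝ 2 V Ω)
    (hgauge : ∀ μ, ∀ z ∈ Ω, V z * A μ z = pd μ V z + B μ z * V z) (ν : Fin 4) {z : Spacetime}
    (hz : z ∈ Ω) : V z * divComp A ν z = divComp B ν z * V z := by
  have hnhds := hΩ.mem_nhds hz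
  have hdiff {A : Fin 4 → Spacetime → 𝔸} (hA : ∀ μ, ContDiffOn ℝ 2 (A μ) Ω) (μ : Fin 4) :
      DifferentiableAt ℝ (curvComp A μ ν) z :=
    ((contDiffOn_curvComp hΩ (m := 1) hA (by norm_num) μ ν).contDiffAt hnhds).differentiableAt
      one_ne_zero
  rw [divComp, divComp, Finset.mul_sum, Finset.sum_mul]
  refine Finset.sum_congr rfl fun μ _ => ?_
  rw [mul_smul_comm, smul_mul_assoc, mul_covPd_of_gauge (hdiff hA μ) (hdiff hB μ)
    ((hV.contDiffAt hnhds).differentiableAt two_ne_zero) (hgauge μ z hz)]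
  exact Filter.eventually_of_mem hnhds fun y hy => mul_curvComp_of_gauge hΩ
    (fun μ => (hA μ).differentiableOn two_ne_zero) (fun μ => (hB μ).differentiableOn two_ne_zero)
    hV hgauge μ ν hy

end Gauge

/-! ### The Hodge star on the coordinate frame -/

theorem dx_e (μ ν : Fin 4) : dx μ (e ν) = if μ = ν then 1 else 0 := by
  refine Fin.cases ?_ (fun i => ?_) μ <;> refine Fin.cases ?_ (fun j => ?_) ν <;>
    simp [dx, e, Fin.succ_ne_zero, (Fin.succ_ne_zero _).symm]

theorem vol_e_perm (σ : Equiv.Perm (Fin 4)) :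
    vol (fun i => e (σ i)) = ((Equiv.Perm.sign σ : ℤ) : ℝ) := by
  have hone : vol e = 1 := by
    change Matrix.det (Matrix.of fun i μ => dx μ (e i)) = 1
    convert Matrix.det_one (n := Fin 4) (R := ℝ) using 2
    ext i μ
    simp only [Matrix.of_apply, dx_e, Matrix.one_apply, eq_comm]
  rw [← zsmul_one, ← Units.smul_def, ← hone]
  exact vol.toAlternatingMap.map_perm e σ

theorem contract_apply {l k : ℕ} (v : Fin k → Spacetime) (w : Spacetime [⋀^Fin (l + k)]→L[ℝ] ℝ)
    (u : Fin l → Spacetime) :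
    contract k v w u = w (Fin.append v u ∘ Fin.cast (add_comm l k)) := by
  induction k with
  | zero =>
    rw [contract, Fin.append_left_nil v u rfl]
    rfl
  | succ k ih =>
    obtain ⟨v₀, v, rfl⟩ : ∃ v₀ v', v = Fin.cons v₀ v' := ⟨_, _, (Fin.cons_self_tail v).symm⟩
    rw [contract, ih, Fin.append_cons]
    refine congrArg w (funext fun i => ?_)
    cases i using Fin.cases <;> rfl

theorem hodge_apply {n k l : ℕ} (h : l + k = 4) (T : Spacetime [⋀^Fin k]→L[ℝ] Mat n)
    (u : Fin l → Spacetime) :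
    hodge h T u = (k.factorial : ℝ)⁻¹ • ∑ α : Fin k → Fin 4, ((∏ i, g (α i)) *
      vol (Fin.append (e ∘ α) u ∘ Fin.cast (by omega))) • T (e ∘ α) := by
  have hcast {N : ℕ} (h : N = 4) (v : Fin N → Spacetime) :
      (h ▸ vol : Spacetime [⋀^Fin N]→L[ℝ] ℝ) v = vol (v ∘ Fin.cast h.symm) := by
    subst h
    rfl
  rw [hodge, ContinuousAlternatingMap.smul_apply, ContinuousAlternatingMap.sum_apply]
  simp only [ContinuousAlternatingMap.smul_apply, ContinuousAlternatingMap.smulRight_apply,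
    contract_apply, mul_smul]
  simp_rw [hcast h]
  rfl

theorem vol_append_comp_perm {k l : ℕ} (h : 4 = k + l) (v : Fin (k + l) → Spacetime)
    (τ : Equiv.Perm (Fin k)) :
    vol (Fin.append (fun i => v (Fin.castAdd l (τ i))) (fun j => v (Fin.natAdd k j)) ∘ Fin.cast h) =
      Equiv.Perm.sign τ • vol (v ∘ Fin.cast h) := by
  let ρ : Equiv.Perm (Fin (k + l)) := finSumFinEquiv.permCongr (Equiv.Perm.sumCongr τ 1)
  let ρ' : Equiv.Perm (Fin 4) := (finCongr h).symm.permCongr ρ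
  have hsign : Equiv.Perm.sign ρ' = Equiv.Perm.sign τ := by
    rw [Equiv.Perm.sign_permCongr, Equiv.Perm.sign_permCongr, Equiv.Perm.sign_sumCongr, map_one,
      mul_one]
  have hcomp : Fin.append (fun i => v (Fin.castAdd l (τ i))) (fun j => v (Fin.natAdd k j)) =
      v ∘ ρ := by
    funext i
    refine Fin.addCases (fun i => ?_) (fun i => ?_) i <;> simp [ρ]
  rw [hcomp, ← hsign]
  exact vol.toAlternatingMap.map_perm (v ∘ Fin.cast h) ρ'

theorem exists_perm_of_injective_append {k l : ℕ} {X : Type*} (σ : Fin (k + l) ≃ X)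
    {α : Fin k → X} (hα : Function.Injective (Fin.append α fun j => σ (Fin.natAdd k j))) :
    ∃ τ : Equiv.Perm (Fin k), (fun i => σ (Fin.castAdd l (τ i))) = α := by
  obtain ⟨hinj, -, hdisjoint⟩ := Fin.append_injective_iff.1 hα
  have hpre (i : Fin k) : ∃ a, σ (Fin.castAdd l a) = α i := by
    obtain ⟨j, hj⟩ := σ.surjective (α i)
    cases j using Fin.addCases with
    | left a => exact ⟨a, hj⟩
    | right b => exact absurd hj.symm (hdisjoint i b)
  choose τ hτ using hpre
  have hτinj : Function.Injective τ := fun i j hij => hinj (by rw [← hτ i, ← hτ j, hij])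
  exact ⟨Equiv.ofBijective τ (Finite.injective_iff_bijective.1 hτinj), funext hτ⟩

theorem exists_perm_of_vol_append_ne_zero {k l : ℕ} (h : 4 = k + l) (σ : Fin (k + l) ≃ Fin 4)
    {α : Fin k → Fin 4}
    (hα : vol (Fin.append (e ∘ α) (fun j => e (σ (Fin.natAdd k j))) ∘ Fin.cast h) ≠ 0) :
    ∃ τ : Equiv.Perm (Fin k), (fun i => σ (Fin.castAdd l (τ i))) = α := by
  have happend : Fin.append (e ∘ α) (fun j => e (σ (Fin.natAdd k j))) =
      e ∘ Fin.append α fun j => σ (Fin.natAdd k j) := by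
    funext i
    cases i using Fin.addCases <;> simp
  have hinj := not_imp_comm.1 (vol.map_eq_zero_of_not_injective _) hα
  rw [happend] at hinj
  exact exists_perm_of_injective_append σ (hinj.of_comp_right (finCongr h).surjective).of_comp

theorem hodge_apply_frame {n k l : ℕ} (h : l + k = 4) (σ : Fin (k + l) ≃ Fin 4)
    (T : Spacetime [⋀^Fin k]→L[ℝ] Mat n) :
    hodge h T (fun j => e (σ (Fin.natAdd k j))) =
      ((∏ i, g (σ (Fin.castAdd l i))) * vol (e ∘ σ ∘ Fin.cast (by omega))) •
        T (fun i => e (σ (Fin.castAdd l i))) := by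
  have hterm (τ : Equiv.Perm (Fin k)) :
      ((∏ i, g (σ (Fin.castAdd l i))) * vol (e ∘ σ ∘ Fin.cast (by omega))) •
        T (fun i => e (σ (Fin.castAdd l i))) =
      ((∏ i, g (σ (Fin.castAdd l (τ i)))) * vol (Fin.append (e ∘ fun i => σ (Fin.castAdd l (τ i)))
        (fun j => e (σ (Fin.natAdd k j))) ∘ Fin.cast (by omega))) •
        T (e ∘ fun i => σ (Fin.castAdd l (τ i))) := by
    have hvol : vol (Fin.append (e ∘ fun i => σ (Fin.castAdd l (τ i)))
        (fun j => e (σ (Fin.natAdd k j))) ∘ Fin.cast (by omega)) =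
        Equiv.Perm.sign τ • vol (e ∘ σ ∘ Fin.cast (by omega)) :=
      vol_append_comp_perm (by omega) (e ∘ σ) τ
    have hT : T (e ∘ fun i => σ (Fin.castAdd l (τ i))) =
        Equiv.Perm.sign τ • T (fun i => e (σ (Fin.castAdd l i))) :=
      T.toAlternatingMap.map_perm (fun i => e (σ (Fin.castAdd l i))) τ
    rw [Equiv.prod_comp τ fun i => g (σ (Fin.castAdd l i)), hvol, hT, mul_smul_comm,
      smul_smul_smul_comm, smul_eq_mul, Int.units_mul_self, one_smul]
  rw [hodge_apply, ← Fintype.sum_of_injective (fun (τ : Equiv.Perm (Fin k)) i =>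
    σ (Fin.castAdd l (τ i))) _ _ _ (fun α hα => ?_) hterm]
  · rw [Finset.sum_const, Finset.card_univ, Fintype.card_perm, Fintype.card_fin,
      ← Nat.cast_smul_eq_nsmul ℝ, inv_smul_smul₀ (by positivity)]
  · intro τ τ' hτ
    exact Equiv.ext fun i => Fin.castAdd_injective k l (σ.injective (congr_fun hτ i))
  · rw [not_imp_comm.1 (exists_perm_of_vol_append_ne_zero (by omega) σ) hα, mul_zero, zero_smul]

theorem hodge_apply_of_perm {n k l : ℕ} (h : l + k = 4) (h' : k + l = 4)
    (σ : Equiv.Perm (Fin 4)) {α : Fin k → Fin 4} {β : Fin l → Fin 4}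
    (hα : ∀ i, σ (Fin.cast h' (Fin.castAdd l i)) = α i)
    (hβ : ∀ j, σ (Fin.cast h' (Fin.natAdd k j)) = β j) (T : Spacetime [⋀^Fin k]→L[ℝ] Mat n) :
    hodge h T (fun j => e (β j)) =
      ((∏ i, g (α i)) * ((Equiv.Perm.sign σ : ℤ) : ℝ)) • T (fun i => e (α i)) := by
  obtain rfl := funext hα
  obtain rfl := funext hβ
  rw [← vol_e_perm]
  exact hodge_apply_frame h ((finCongr h').trans σ) T

/-! ### The components of the source -/

section Smoothness

variable {E F : Type*} [NormedAddCommGroup E] [NormedSpace ℝ E] [NormedAddCommGroup F]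
  [NormedSpace ℝ F] {k : ℕ} {m m' : WithTop ℕ∞}

theorem contDiff_alternating_smulRight (f : E [⋀^Fin k]→L[ℝ] ℝ) :
    ContDiff ℝ m fun w : F => f.smulRight w := by
  let L : F →L[ℝ] E [⋀^Fin k]→L[ℝ] F :=
    ((ContinuousLinearMap.compContinuousAlternatingMapCLM ℝ E ℝ F (ι := Fin k)).flip f).comp
      (ContinuousLinearMap.smulRightL ℝ ℝ F (ContinuousLinearMap.id ℝ ℝ))
  exact L.contDiff

theorem contDiff_alternating_apply (v : Fin k → E) :
    ContDiff ℝ m fun T : E [⋀^Fin k]→L[ℝ] F => T v :=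
  (ContinuousAlternatingMap.apply ℝ E F v).contDiff

theorem contDiff_alternatizeUncurryFin : ContDiff ℝ m fun f : E →L[ℝ] E [⋀^Fin k]→L[ℝ] F =>
    ContinuousAlternatingMap.alternatizeUncurryFin f := by
  have h := ContinuousLinearMap.contDiff (𝕜 := ℝ) (E := E →L[ℝ] E [⋀^Fin k]→L[ℝ] F)
    (F := E [⋀^Fin (k + 1)]→L[ℝ] F) (n := m)
    (ContinuousAlternatingMap.alternatizeUncurryFinCLM ℝ E F)
  exact h

theorem contDiff_alternatizeUncurryFin_bilinear (b : F →L[ℝ] F →L[ℝ] F) :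
    ContDiff ℝ m fun p : (E →L[ℝ] F) × (E [⋀^Fin k]→L[ℝ] F) =>
      ContinuousAlternatingMap.alternatizeUncurryFin
        (((ContinuousLinearMap.compContinuousAlternatingMapCLM ℝ E F F
          (ι := Fin k)).flip p.2).comp (b.comp p.1)) :=
  contDiff_alternatizeUncurryFin.comp (((ContinuousLinearMap.contDiff _).comp contDiff_snd).clm_comp
    (contDiff_const.clm_comp contDiff_fst))

theorem contDiffOn_extDerivWithin {s : Set E} (hs : UniqueDiffOn ℝ s)
    {w : E → E [⋀^Fin k]→L[ℝ] F} (hw : ContDiffOn ℝ m' w s) (hm : m + 1 ≤ m') :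
    ContDiffOn ℝ m (extDerivWithin w s) s :=
  contDiff_alternatizeUncurryFin.comp_contDiffOn (hw.fderivWithin hs hm)

variable {n : ℕ}

theorem contDiff_hodge {k l : ℕ} (h : l + k = 4) :
    ContDiff ℝ m fun T : Spacetime [⋀^Fin k]→L[ℝ] Mat n => hodge h T :=
  ContDiff.const_smul _ (ContDiff.sum fun (α : Fin k → Fin 4) _ => ContDiff.const_smul _
    ((contDiff_alternating_smulRight _).comp (contDiff_alternating_apply fun i => e (α i))))

theorem contDiff_oneForm : ContDiff ℝ m fun a : Spacetime →L[ℝ] Mat n => oneForm a :=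
  (ContinuousAlternatingMap.ofSubsingletonLIE (𝕜 := ℝ) (E := Spacetime) (F := Mat n)
    (0 : Fin 1)).contDiff

theorem contDiff_bracket : ContDiff ℝ m
    fun p : (Spacetime →L[ℝ] Mat n) × (Spacetime [⋀^Fin k]→L[ℝ] Mat n) => bracket p.1 p.2 :=
  contDiff_alternatizeUncurryFin_bilinear (ad n)

theorem contDiffOn_curvature {A : Spacetime → Spacetime →L[ℝ] Mat n}
    (hA : ContDiffOn ℝ m' A diamond) (hm : m + 1 ≤ m') :
    ContDiffOn ℝ m (curvature A) diamond := by
  have hform : ContDiffOn ℝ m' (fun y => oneForm (A y)) diamond :=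
    contDiff_oneForm.comp_contDiffOn hA
  have hmm' : m ≤ m' := le_self_add.trans hm
  exact (contDiffOn_extDerivWithin uniqueDiffOn_diamond hform hm).add
    ((contDiff_bracket.comp_contDiffOn ((hA.of_le hmm').prodMk (hform.of_le hmm'))).const_smul _)

end Smoothness

section Source

attribute [local instance] LieRing.ofAssociativeRing

variable {n : ℕ} {A : Spacetime → Spacetime →L[ℝ] Mat n}

/-- The components `A_μ` of a connection. -/
def component (A : Spacetime → Spacetime →L[ℝ] Mat n) (μ : Fin 4) (z : Spacetime) : Mat n :=
  A z (e μ)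

theorem bracket_apply {k : ℕ} (a : Spacetime →L[ℝ] Mat n) (w : Spacetime [⋀^Fin k]→L[ℝ] Mat n)
    (v : Fin (k + 1) → Spacetime) :
    bracket a w v = ∑ i, (-1) ^ i.val • ⁅a (v i), w (i.removeNth v)⁆ := by
  rw [bracket, ContinuousAlternatingMap.alternatizeUncurryFin_apply]
  rfl

theorem extDerivWithin_diamond_apply {k : ℕ} {w : Spacetime → Spacetime [⋀^Fin k]→L[ℝ] Mat n}
    {z : Spacetime} (hz : z ∈ interior diamond) (hw : DifferentiableAt ℝ w z)
    (α : Fin (k + 1) → Fin 4) : extDerivWithin w diamond z (fun i => e (α i)) =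
      ∑ i, (-1) ^ i.val • pd (α i) (fun y => w y fun j => e (i.removeNth α j)) z := by
  rw [extDerivWithin_apply hw.differentiableWithinAt (uniqueDiffOn_diamond z (interior_subset hz))]
  simp only [fderivWithin_of_mem_nhds (mem_interior_iff_mem_nhds.1 hz)]
  rfl

theorem covD_apply {k : ℕ} {w : Spacetime → Spacetime [⋀^Fin k]→L[ℝ] Mat n} {z : Spacetime}
    (hz : z ∈ interior diamond) (hw : DifferentiableAt ℝ w z) (α : Fin (k + 1) → Fin 4) :
    covD A w z (fun i => e (α i)) = ∑ i, (-1) ^ i.val •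
      covPd (component A) (α i) (fun y => w y fun j => e (i.removeNth α j)) z := by
  rw [covD, ContinuousAlternatingMap.add_apply, extDerivWithin_diamond_apply hz hw, bracket_apply,
    ← Finset.sum_add_distrib]
  refine Finset.sum_congr rfl fun i _ => ?_
  rw [← smul_add]
  rfl

theorem curvature_apply {z : Spacetime} (hz : z ∈ interior diamond) (hA : DifferentiableAt ℝ A z)
    (α : Fin 2 → Fin 4) :
    curvature A z (fun i => e (α i)) = curvComp (component A) (α 0) (α 1) z := by
  have hform : DifferentiableAt ℝ (fun y => oneForm (A y)) z :=
    ((contDiff_oneForm (m := 1)).differentiable one_ne_zero _).comp z hA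
  have hsum (f : Fin 2 → Mat n) : ∑ i, (-1) ^ i.val • f i = f 0 - f 1 := by
    simp [Fin.sum_univ_two, sub_eq_add_neg]
  rw [curvature, ContinuousAlternatingMap.add_apply, ContinuousAlternatingMap.smul_apply,
    extDerivWithin_diamond_apply hz hform, bracket_apply, hsum, hsum]
  change pd (α 0) (component A (α 1)) z - pd (α 1) (component A (α 0)) z + (2⁻¹ : ℝ) •
    (⁅component A (α 0) z, component A (α 1) z⁆ - ⁅component A (α 1) z, component A (α 0) z⁆) = _
  rw [← lie_skew (component A (α 1) z), curvComp]
  module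

theorem exists_perm_complement : ∀ i : Fin 3, ∃ ρ : Equiv.Perm (Fin 4),
    Equiv.Perm.sign ρ = (-1) ^ i.val ∧ ρ 0 = i.castSucc ∧ ρ 1 = 3 ∧
      ρ 2 = (i.succAbove 0).castSucc ∧ ρ 3 = (i.succAbove 1).castSucc := by
  decide

theorem hodge_curvature_apply {z : Spacetime} (hz : z ∈ interior diamond)
    (hA : DifferentiableAt ℝ A z) (σ : Equiv.Perm (Fin 4)) {β : Fin 2 → Fin 4} (h0 : σ 2 = β 0)
    (h1 : σ 3 = β 1) : hodge (k := 2) (l := 2) rfl (curvature A z) (fun j => e (β j)) =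
      (g (σ 0) * g (σ 1) * ((Equiv.Perm.sign σ : ℤ) : ℝ)) •
        curvComp (component A) (σ 0) (σ 1) z := by
  rw [hodge_apply_of_perm rfl rfl σ (α := ![σ 0, σ 1]) (Fin.forall_fin_two.2 ⟨rfl, rfl⟩)
    (Fin.forall_fin_two.2 ⟨h0, h1⟩), curvature_apply hz hA, Fin.prod_univ_two]
  rfl

theorem covD_hodge_curvature_apply (hA : ContDiffOn ℝ 2 A diamond) {z : Spacetime}
    (hz : z ∈ interior diamond) (σ : Equiv.Perm (Fin 4)) :
    covD A (fun y => hodge (k := 2) (l := 2) rfl (curvature A y)) z (fun i => e (σ i.castSucc)) =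
      (g (σ 3) * ((Equiv.Perm.sign σ : ℤ) : ℝ)) • ∑ i : Fin 3, g (σ i.castSucc) •
        covPd (component A) (σ i.castSucc) (curvComp (component A) (σ i.castSucc) (σ 3)) z := by
  have hnhds := mem_interior_iff_mem_nhds.1 hz
  have hdiff : DifferentiableAt ℝ (fun y => hodge (k := 2) (l := 2) rfl (curvature A y)) z :=
    ((contDiff_hodge (m := 1) rfl).differentiable one_ne_zero _).comp z
      (((contDiffOn_curvature (m := 1) hA (by norm_num)).contDiffAt hnhds).differentiableAt
        one_ne_zero)
  rw [covD_apply hz hdiff fun i => σ i.castSucc, Finset.smul_sum]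
  refine Finset.sum_congr rfl fun i _ => ?_
  obtain ⟨ρ, hsign, h0, h1, h2, h3⟩ := exists_perm_complement i
  have hstar : (fun y => hodge (k := 2) (l := 2) rfl (curvature A y)
      fun j => e (i.removeNth (fun i => σ i.castSucc) j)) =ᶠ[𝓝 z] fun y =>
      (g (σ i.castSucc) * g (σ 3) * (-1) ^ i.val * ((Equiv.Perm.sign σ : ℤ) : ℝ)) •
        curvComp (component A) (σ i.castSucc) (σ 3) y := by
    filter_upwards [isOpen_interior.mem_nhds hz] with y hy
    have hAy := (hA.contDiffAt (mem_interior_iff_mem_nhds.1 hy)).differentiableAt two_ne_zero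
    rw [hodge_curvature_apply hy hAy (σ * ρ) (β := i.removeNth fun i => σ i.castSucc)
      (congrArg σ h2) (congrArg σ h3), Equiv.Perm.sign_mul, hsign, Equiv.Perm.mul_apply,
      Equiv.Perm.mul_apply, h0, h1]
    push_cast
    rw [mul_comm ((Equiv.Perm.sign σ : ℤ) : ℝ), mul_assoc _ _ ((Equiv.Perm.sign σ : ℤ) : ℝ)]
  have hpow : ((-1 : ℝ) ^ i.val) * (-1) ^ i.val = 1 := by
    rw [← mul_pow, neg_mul_neg, one_mul, one_pow]
  rw [covPd_congr hstar, covPd_const_smul, smul_smul, ← Int.cast_smul_eq_zsmul ℝ, smul_smul]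
  push_cast
  congr 1
  linear_combination (g (σ i.castSucc) * g (σ 3) * ((Equiv.Perm.sign σ : ℤ) : ℝ)) * hpow

theorem source_apply (hA : ContDiffOn ℝ 2 A diamond) {z : Spacetime}
    (hz : z ∈ interior diamond) (ν : Fin 4) :
    source A z (fun _ => e ν) = -divComp (component A) ν z := by
  let σ : Equiv.Perm (Fin 4) := Equiv.swap 3 ν
  have hσ : σ 3 = ν := Equiv.swap_apply_left 3 ν
  have hmetric : (∏ i : Fin 3, g (σ i.castSucc)) * g ν = -1 := by
    rw [← hσ]
    refine (Fin.prod_univ_castSucc fun i => g (σ i)).symm.trans ?_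
    rw [Equiv.prod_comp σ g, Fin.prod_univ_succ]
    simp [g, Fin.succ_ne_zero]
  have hsign : ((Equiv.Perm.sign σ : ℤ) : ℝ) * ((Equiv.Perm.sign σ : ℤ) : ℝ) = 1 := by
    rw [← Int.cast_mul, ← Units.val_mul, Int.units_mul_self, Units.val_one, Int.cast_one]
  have hdiv : divComp (component A) ν z = ∑ i : Fin 3, g (σ i.castSucc) •
      covPd (component A) (σ i.castSucc) (curvComp (component A) (σ i.castSucc) (σ 3)) z := by
    rw [divComp, ← hσ, ← Equiv.sum_comp σ, Fin.sum_univ_castSucc]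
    refine add_eq_left.2 ?_
    rw [show Fin.last 3 = 3 from rfl, covPd_curvComp_self, smul_zero]
  rw [source, hodge_apply_of_perm rfl rfl σ (α := fun i => σ i.castSucc) (β := fun _ => ν)
    (fun _ => rfl) (Fin.forall_fin_one.2 hσ), covD_hodge_curvature_apply hA hz σ, ← hdiv, hσ,
    smul_smul, ← neg_one_smul ℝ]
  congr 1
  linear_combination ((Equiv.Perm.sign σ : ℤ) : ℝ) * ((Equiv.Perm.sign σ : ℤ) : ℝ) * hmetric -
    hsign

end Source

/-! ### Gauge transformations -/

section GaugeAction

variable {n : ℕ} {A B : Spacetime → Spacetime →L[ℝ] Mat n} {U V : Spacetime → GL (Fin n) ℂ}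

theorem mul_gaugeAct (U : Spacetime → GL (Fin n) ℂ) (B : Spacetime → Spacetime →L[ℝ] Mat n)
    (z v : Spacetime) :
    (U z : Mat n) * gaugeAct U B z v = dGauge U z v + B z v * (U z : Mat n) :=
  (U z).mul_inv_cancel_left _

theorem gaugeAct_time_eq_zero_iff {z : Spacetime} (hB : B z (e 0) = 0) :
    gaugeAct U B z (e 0) = 0 ↔ dGauge U z (e 0) = 0 := by
  rw [← (U z).mul_right_eq_zero, mul_gaugeAct, hB, zero_mul, add_zero]

theorem contDiffOn_units_inv {E 𝔸 : Type*} [NormedAddCommGroup E] [NormedSpace ℝ E]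
    [NormedRing 𝔸] [NormedAlgebra ℝ 𝔸] [CompleteSpace 𝔸] {m : WithTop ℕ∞} {s : Set E}
    {V : E → 𝔸ˣ} (hV : ContDiffOn ℝ m (fun z => (V z : 𝔸)) s) :
    ContDiffOn ℝ m (fun z => ((V z)⁻¹ : 𝔸ˣ).val) s := by
  simp only [← Ring.inverse_unit]
  exact fun z hz => ContDiffAt.comp_contDiffWithinAt (g := Ring.inverse) z
    (contDiffAt_ringInverse ℝ (V z)) (hV z hz)

theorem contDiffOn_gaugeAct {m : WithTop ℕ∞}
    (hV : ContDiffOn ℝ (m + 1) (fun z => (V z : Mat n)) diamond)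
    (hB : ContDiffOn ℝ m B diamond) : ContDiffOn ℝ m (gaugeAct V B) diamond := by
  have hVm : ContDiffOn ℝ m (fun z => (V z : Mat n)) diamond := hV.of_le le_self_add
  have hdV : ContDiffOn ℝ m (dGauge V) diamond := hV.fderivWithin uniqueDiffOn_diamond le_rfl
  have hmul := (ContinuousLinearMap.mul ℝ (Mat n)).contDiff (n := m)
  have hmul_flip := (ContinuousLinearMap.mul ℝ (Mat n)).flip.contDiff (n := m)
  exact (hmul.comp_contDiffOn (contDiffOn_units_inv hVm)).clm_comp
    (hdV.add ((hmul_flip.comp_contDiffOn hVm).clm_comp hB))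

theorem gaugeAct_congr {M : Set Spacetime} (hM : IsOpen M) (h : EqOn V U (M ∩ diamond)) :
    EqOn (gaugeAct V B) (gaugeAct U B) (M ∩ diamond) := by
  intro z hz
  have hd : dGauge V z = dGauge U z := by
    refine Filter.EventuallyEq.fderivWithin_eq ?_ (by rw [h hz])
    filter_upwards [inter_mem_nhdsWithin diamond (hM.mem_nhds hz.1)] with y hy
    rw [h hy.symm]
  rw [gaugeAct, gaugeAct, hd, h hz]

theorem dGauge_of_mem_interior {z : Spacetime} (hz : z ∈ interior diamond) (μ : Fin 4) :
    dGauge V z (e μ) = pd μ (fun y => (V y : Mat n)) z := by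
  rw [dGauge, fderivWithin_of_mem_nhds (mem_interior_iff_mem_nhds.1 hz), pd]

theorem contDiffOn_component {m : WithTop ℕ∞} (hA : ContDiffOn ℝ m A diamond) (μ : Fin 4) :
    ContDiffOn ℝ m (component A μ) (interior diamond) :=
  (hA.mono interior_subset).clm_apply contDiffOn_const

theorem mul_source_gaugeAct (hV : ContDiffOn ℝ 3 (fun z => (V z : Mat n)) diamond)
    (hB : ContDiffOn ℝ 2 B diamond) {z : Spacetime} (hz : z ∈ interior diamond) (ν : Fin 4) :
    (V z : Mat n) * source (gaugeAct V B) z (fun _ => e ν) =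
      source B z (fun _ => e ν) * (V z : Mat n) := by
  have hVB : ContDiffOn ℝ 2 (gaugeAct V B) diamond := contDiffOn_gaugeAct hV hB
  have hgauge (μ : Fin 4) (y : Spacetime) (hy : y ∈ interior diamond) :
      (V y : Mat n) * component (gaugeAct V B) μ y =
        pd μ (fun y => (V y : Mat n)) y + component B μ y * (V y : Mat n) := by
    rw [component, mul_gaugeAct, dGauge_of_mem_interior hy, component]
  rw [source_apply hVB hz, source_apply hB hz, mul_neg, neg_mul,
    mul_divComp_of_gauge isOpen_interior (contDiffOn_component hVB) (contDiffOn_component hB)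
      ((hV.mono interior_subset).of_le (by norm_num)) hgauge ν hz]

end GaugeAction

/-! ### The time-independent extension of a gauge transformation -/

section StaticExtension

variable {n : ℕ} {U : Spacetime → GL (Fin n) ℂ} {ε₀ : ℝ}

/-- The projection along the time axis onto the cone `|x| = t + 1` carrying `∂⁻𝔻`. -/
def lowerProj (z : Spacetime) : Spacetime :=
  (‖z.2‖ - 1, z.2)

/-- The gauge transformation `V(t, x) = U(|x| - 1, x)`, which does not depend on time and agrees
with `U` on the lower boundary. -/
def staticExtension (U : Spacetime → GL (Fin n) ℂ) (z : Spacetime) : GL (Fin n) ℂ :=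
  U (lowerProj z)

theorem lowerProj_mem_lowerBdry {z : Spacetime} (hz : z ∈ diamond) : lowerProj z ∈ lowerBdry := by
  refine ⟨⟨(sub_add_cancel _ _).ge, ?_⟩, (sub_add_cancel _ _).symm⟩
  simp only [lowerProj]
  linarith [hz.1, hz.2]

theorem eq_one_of_mem_lowerBdry (hU : ContinuousOn (fun z => (U z : Mat n)) diamond)
    {N : Set Spacetime} (hN : IsOpen N) (hlower : lowerBdry ⊆ N) (hU1 : ∀ z ∈ N ∩ obs ε₀, U z = 1)
    {z : Spacetime} (hz : z ∈ lowerBdry) (hzε : ‖z.2‖ < ε₀) : U z = 1 := by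
  have hopen : IsOpen (N ∩ {y : Spacetime | ‖y.2‖ < ε₀}) :=
    hN.inter (isOpen_lt (by fun_prop) (by fun_prop))
  have hclosure : z ∈ closure (N ∩ obs ε₀) := by
    refine closure_mono ?_ (hopen.inter_closure
      ⟨⟨hlower hz, hzε⟩, closure_interior_diamond.symm ▸ hz.1⟩)
    exact fun y hy => ⟨hy.1.1, hy.2, hy.1.2⟩
  have hone : EqOn (fun y => (U y : Mat n)) (fun _ => 1) (diamond ∩ closure (N ∩ obs ε₀)) :=
    EqOn.of_subset_closure (s := N ∩ obs ε₀) (fun y hy => by rw [hU1 y hy, Units.val_one])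
      (hU.mono inter_subset_left) continuousOn_const
      (fun y hy => ⟨interior_subset hy.2.1, subset_closure hy⟩) inter_subset_right
  exact Units.ext (hone ⟨hz.1, hclosure⟩)

theorem contDiffOn_staticExtension {m : ℕ∞}
    (hU : ContDiffOn ℝ m (fun z => (U z : Mat n)) diamond) (hε₀ : 0 < ε₀)
    (hU1 : ∀ z ∈ lowerBdry, ‖z.2‖ < ε₀ → U z = 1) :
    ContDiffOn ℝ m (fun z => (staticExtension U z : Mat n)) diamond := by
  intro z hz
  by_cases hx : z.2 = 0
  · have hzε : ‖z.2‖ < ε₀ := by rwa [hx, norm_zero]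
    have hnear : {y : Spacetime | ‖y.2‖ < ε₀} ∈ 𝓝 z :=
      (isOpen_lt (by fun_prop) (by fun_prop)).mem_nhds hzε
    have hone : ∀ y ∈ diamond, ‖y.2‖ < ε₀ → (staticExtension U y : Mat n) = 1 := fun y hy hyε =>
      congrArg Units.val (hU1 _ (lowerProj_mem_lowerBdry hy) hyε)
    refine (contDiffWithinAt_const (c := (1 : Mat n))).congr_of_eventuallyEq ?_
      (hone z hz hzε)
    filter_upwards [inter_mem_nhdsWithin diamond hnear] with y hy using hone y hy.1 hy.2
  · have hproj : ContDiffAt ℝ m lowerProj z :=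
      ((contDiffAt_snd.norm ℝ hx).sub contDiffAt_const).prodMk contDiffAt_snd
    exact ContDiffWithinAt.comp (g := fun y => (U y : Mat n)) z
      (hU _ (lowerProj_mem_lowerBdry hz).1) hproj.contDiffWithinAt
      fun y hy => (lowerProj_mem_lowerBdry hy).1

theorem isGauge_staticExtension {G : Subgroup (GL (Fin n) ℂ)} (hU : IsGauge G U) (hε₀ : 0 < ε₀)
    (hU1 : ∀ z ∈ lowerBdry, ‖z.2‖ < ε₀ → U z = 1) : IsGauge G (staticExtension U) where
  contDiffOn := contDiffOn_staticExtension hU.contDiffOn hε₀ hU1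
  mem _ hz := hU.mem _ (lowerProj_mem_lowerBdry hz).1

theorem dGauge_staticExtension_time {z : Spacetime} (hz : z ∈ interior diamond)
    (hd : DifferentiableAt ℝ (fun y => (staticExtension U y : Mat n)) z) :
    dGauge (staticExtension U) z (e 0) = 0 := by
  have hconst (t : ℝ) : staticExtension U (z + t • e 0) = staticExtension U z := by
    simp [staticExtension, lowerProj, e]
  rw [dGauge_of_mem_interior hz, pd, ← hd.lineDeriv_eq_fderiv, lineDeriv]
  simp only [hconst, deriv_const]

theorem eq_of_dGauge_time_eq_zero
    (hU : DifferentiableOn ℝ (fun z => (U z : Mat n)) diamond) {a b : ℝ}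
    {x : EuclideanSpace ℝ (Fin 3)} (hab : a ≤ b)
    (hmem : ∀ s ∈ Icc a b, ((s, x) : Spacetime) ∈ diamond)
    (hdU : ∀ s ∈ Icc a b, dGauge U (s, x) (e 0) = 0) : U (b, x) = U (a, x) := by
  have hderiv : ∀ s ∈ Icc a b,
      HasDerivWithinAt (fun s : ℝ => (U (s, x) : Mat n)) 0 (Icc a b) s := by
    intro s hs
    have hline : HasDerivWithinAt (fun s : ℝ => ((s, x) : Spacetime)) (e 0) (Icc a b) s :=
      (hasDerivWithinAt_id s _).prodMk (hasDerivWithinAt_const s _ x)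
    have hchain := (hU _ (hmem s hs)).hasFDerivWithinAt.comp_hasDerivWithinAt s hline hmem
    rwa [← dGauge, hdU s hs] at hchain
  refine Units.ext (constant_of_derivWithin_zero (f := fun s : ℝ => (U (s, x) : Mat n))
    (fun s hs => (hderiv s hs).differentiableWithinAt) (fun s hs => ?_) b ⟨hab, le_rfl⟩)
  exact (hderiv s ⟨hs.1, hs.2.le⟩).derivWithin
    (uniqueDiffOn_Icc (hs.1.trans_lt hs.2) s ⟨hs.1, hs.2.le⟩)

/-- The set of points less than `δ` in time above the cone `|x| = t + 1`: a collar of `∂⁻𝔻` that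
is convex in time. -/
def collar (δ : ℝ) : Set Spacetime :=
  {z | z.1 < ‖z.2‖ - 1 + δ}

theorem isOpen_collar (δ : ℝ) : IsOpen (collar δ) :=
  isOpen_lt (by fun_prop) (by fun_prop)

theorem lowerBdry_subset_collar {δ : ℝ} (hδ : 0 < δ) : lowerBdry ⊆ collar δ := fun z hz =>
  show z.1 < ‖z.2‖ - 1 + δ by linarith [hz.2]

theorem exists_collar_inter_diamond_subset {N : Set Spacetime} (hN : IsOpen N)
    (hlower : lowerBdry ⊆ N) : ∃ δ > 0, collar δ ∩ diamond ⊆ N := by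
  obtain ⟨δ, hδ, hδN⟩ := isCompact_lowerBdry.exists_thickening_subset_open hN hlower
  refine ⟨δ, hδ, fun z ⟨hzδ, hz⟩ => hδN (Metric.mem_thickening_iff.2
    ⟨lowerProj z, lowerProj_mem_lowerBdry hz, ?_⟩)⟩
  have htime : z.1 < ‖z.2‖ - 1 + δ := hzδ
  rw [Prod.dist_eq, lowerProj, dist_self, max_eq_left dist_nonneg, Real.dist_eq, abs_lt]
  constructor <;> linarith [hz.1]

theorem eqOn_staticExtension_collar {δ : ℝ}
    (hU : DifferentiableOn ℝ (fun z => (U z : Mat n)) diamond)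
    (hdU : ∀ z ∈ collar δ ∩ diamond, dGauge U z (e 0) = 0) :
    EqOn (staticExtension U) U (collar δ ∩ diamond) := by
  rintro ⟨t, x⟩ ⟨htime, hlow, hup⟩
  have hsegment : ∀ s ∈ Icc (‖x‖ - 1) t, ((s, x) : Spacetime) ∈ collar δ ∩ diamond :=
    fun s hs => ⟨hs.2.trans_lt htime, sub_le_iff_le_add.1 hs.1, hup.trans (by gcongr; exact hs.2)⟩
  exact (eq_of_dGauge_time_eq_zero hU (sub_le_iff_le_add.2 hlow)
    (fun s hs => (hsegment s hs).2) fun s hs => hdU _ (hsegment s hs)).symm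

end StaticExtension

/-! ### Uniqueness -/

section Uniqueness

variable {n : ℕ} {A B : Spacetime → Spacetime →L[ℝ] Mat n}

theorem ext_e {F : Type*} [AddCommMonoid F] [Module ℝ F] [TopologicalSpace F]
    {f h : Spacetime →L[ℝ] F} (hfh : ∀ μ, f (e μ) = h (e μ)) : f = h := by
  refine ContinuousLinearMap.ext fun v => ?_
  rw [← sum_dx_smul_e v]
  simp only [map_sum, map_smul, hfh]

theorem eqOn_of_source_eq (hA : ContDiffOn ℝ 2 A diamond) (hB : ContDiffOn ℝ 2 B diamond)
    (hA0 : ∀ z ∈ interior diamond, A z (e 0) = 0) (hB0 : ∀ z ∈ interior diamond, B z (e 0) = 0)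
    {M : Set Spacetime} (hM : IsOpen M) (hlower : lowerBdry ⊆ M) (hAB : EqOn A B (M ∩ diamond))
    (hsource : ∀ z ∈ interior diamond, ∀ k : Fin 3,
      source A z (fun _ => e k.succ) = source B z (fun _ => e k.succ)) : EqOn A B diamond := by
  have hcomponent (μ : Fin 4) : EqOn (component A μ) (component B μ) (interior diamond) := by
    refine eqOn_of_divComp_eq (contDiffOn_component hA) (contDiffOn_component hB) hA0 hB0 hM
      hlower (fun μ z hz => ?_) (fun k z hz => ?_) μ
    · rw [component, component, hAB ⟨hz.1, interior_subset hz.2⟩]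
    · rw [← neg_inj, ← source_apply hA hz, ← source_apply hB hz, hsource z hz k]
  have hinterior : EqOn A B (interior diamond) := fun z hz => ext_e fun μ => hcomponent μ hz
  exact hinterior.of_subset_closure hA.continuousOn hB.continuousOn interior_subset
    closure_interior_diamond.ge

theorem source_eq_source_gaugeAct {ε₀ : ℝ} {V : Spacetime → GL (Fin n) ℂ}
    (hV : ContDiffOn ℝ 3 (fun z => (V z : Mat n)) diamond) (hV1 : ∀ z ∈ obs ε₀, V z = 1)
    (hB : ContDiffOn ℝ 2 B diamond) (hAYM : ∀ z ∈ diamond \ obs ε₀, source A z = 0)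
    (hBYM : ∀ z ∈ diamond \ obs ε₀, source B z = 0)
    (hAB : ∀ z ∈ obs ε₀, source A z = source B z) {z : Spacetime} (hz : z ∈ interior diamond)
    (ν : Fin 4) : source A z (fun _ => e ν) = source (gaugeAct V B) z (fun _ => e ν) := by
  have hcov := mul_source_gaugeAct hV hB hz ν
  by_cases hobs : z ∈ obs ε₀
  · rw [hV1 z hobs, Units.val_one, one_mul, mul_one] at hcov
    rw [hAB z hobs, hcov]
  · have hout : z ∈ diamond \ obs ε₀ := ⟨interior_subset hz, hobs⟩
    rw [hBYM z hout, ContinuousAlternatingMap.coe_zero, Pi.zero_apply, zero_mul] at hcov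
    rw [hAYM z hout, ContinuousAlternatingMap.coe_zero, Pi.zero_apply,
      (V z).mul_right_eq_zero.1 hcov]

end Uniqueness

end YM

end

theorem mainTheorem7_general (n : ℕ) (G : Subgroup (GL (Fin n) ℂ)) (ε₀ : ℝ) (hε₀ : 0 < ε₀)
    (A B : YM.Spacetime → YM.Spacetime →L[ℝ] YM.Mat n)
    (hA : ContDiffOn ℝ 2 A YM.diamond) (hB : ContDiffOn ℝ 2 B YM.diamond)
    (hAYM : ∀ z ∈ YM.diamond \ YM.obs ε₀, YM.source A z = 0)
    (hBYM : ∀ z ∈ YM.diamond \ YM.obs ε₀, YM.source B z = 0)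
    (hAB : ∀ z ∈ YM.obs ε₀, YM.source A z = YM.source B z)
    (U : YM.Spacetime → GL (Fin n) ℂ) (hU : YM.IsGauge G U)
    (N : Set YM.Spacetime) (hN : IsOpen N) (hNbdry : YM.lowerBdry ⊆ N)
    (hAUB : ∀ z ∈ N ∩ YM.diamond, A z = YM.gaugeAct U B z)
    (hUid : ∃ N₁ : Set YM.Spacetime, IsOpen N₁ ∧ YM.lowerBdry ⊆ N₁ ∧
      ∀ z ∈ N₁ ∩ YM.obs ε₀, U z = 1)
    (hAtemp : YM.IsTemporal A) (hBtemp : YM.IsTemporal B) :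
    (∀ z ∈ N ∩ YM.diamond, YM.dGauge U z (YM.e 0) = 0) ∧
    ∃ V : YM.Spacetime → GL (Fin n) ℂ, YM.IsGauge G V ∧
      (∀ (s t : ℝ) (x : EuclideanSpace ℝ (Fin 3)),
        (s, x) ∈ YM.diamond → (t, x) ∈ YM.diamond → V (s, x) = V (t, x)) ∧
      (∃ N₂ : Set YM.Spacetime, IsOpen N₂ ∧ YM.lowerBdry ⊆ N₂ ∧
        ∀ z ∈ N₂ ∩ YM.diamond, V z = U z) ∧
      ∀ z ∈ YM.diamond, A z = YM.gaugeAct V B z := by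
  have hdU : ∀ z ∈ N ∩ YM.diamond, YM.dGauge U z (YM.e 0) = 0 := fun z hz =>
    (YM.gaugeAct_time_eq_zero_iff (hBtemp z hz.2)).1 (hAUB z hz ▸ hAtemp z hz.2)
  obtain ⟨N₁, hN₁, hN₁bdry, hU1⟩ := hUid
  have hbdry1 : ∀ z ∈ YM.lowerBdry, ‖z.2‖ < ε₀ → U z = 1 := fun z =>
    YM.eq_one_of_mem_lowerBdry hU.contDiffOn.continuousOn hN₁ hN₁bdry hU1
  obtain ⟨δ, hδ, hδN⟩ := YM.exists_collar_inter_diamond_subset hN hNbdry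
  have hM := YM.isOpen_collar δ
  have hbdryM := YM.lowerBdry_subset_collar hδ
  have hVU : EqOn (YM.staticExtension U) U (YM.collar δ ∩ YM.diamond) :=
    YM.eqOn_staticExtension_collar (hU.contDiffOn.differentiableOn (by simp))
      fun z hz => hdU z ⟨hδN hz, hz.2⟩
  have hV := YM.isGauge_staticExtension hU hε₀ hbdry1
  have hV3 : ContDiffOn ℝ 3 (fun z => (YM.staticExtension U z : YM.Mat n)) YM.diamond :=
    contDiffOn_infty.1 hV.contDiffOn 3
  refine ⟨hdU, YM.staticExtension U, hV, fun _ _ _ _ _ => rfl, ⟨_, hM, hbdryM, hVU⟩, ?_⟩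
  refine YM.eqOn_of_source_eq hA (YM.contDiffOn_gaugeAct hV3 hB)
    (fun z hz => hAtemp z (interior_subset hz)) (fun z hz => ?_) hM hbdryM (fun z hz => ?_)
    fun z hz k => YM.source_eq_source_gaugeAct hV3 (fun y hy => ?_) hB hAYM hBYM hAB hz k.succ
  · exact (YM.gaugeAct_time_eq_zero_iff (hBtemp z (interior_subset hz))).2
      (YM.dGauge_staticExtension_time hz
        ((hV3.contDiffAt (mem_interior_iff_mem_nhds.1 hz)).differentiableAt (by norm_num)))
  · rw [hAUB z ⟨hδN hz, hz.2⟩, YM.gaugeAct_congr hM hVU hz]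
  · exact hbdry1 _ (YM.lowerProj_mem_lowerBdry (interior_subset hy.1)) hy.2

theorem mainTheorem7 (n : ℕ) (G : Subgroup (GL (Fin n) ℂ))
    (hGcompact : IsCompact (G : Set (GL (Fin n) ℂ)))
    (hGconn : IsConnected (G : Set (GL (Fin n) ℂ)))
    (ε₀ : ℝ) (hε₀ : 0 < ε₀) (hε₁ : ε₀ < 1)
    (A B : YM.Spacetime → YM.Spacetime →L[ℝ] YM.Mat n)
    (hA : YM.IsConnection G A) (hB : YM.IsConnection G B)
    (hAYM : ∀ z ∈ YM.diamond \ YM.obs ε₀, YM.source A z = 0)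
    (hBYM : ∀ z ∈ YM.diamond \ YM.obs ε₀, YM.source B z = 0)
    (hAB : ∀ z ∈ YM.obs ε₀, YM.source A z = YM.source B z)
    (U : YM.Spacetime → GL (Fin n) ℂ) (hU : YM.IsGauge G U)
    (N : Set YM.Spacetime) (hN : IsOpen N) (hNbdry : YM.lowerBdry ⊆ N)
    (hAUB : ∀ z ∈ N ∩ YM.diamond, A z = YM.gaugeAct U B z)
    (hUid : ∃ N₁ : Set YM.Spacetime, IsOpen N₁ ∧ YM.lowerBdry ⊆ N₁ ∧
      ∀ z ∈ N₁ ∩ YM.obs ε₀, U z = 1)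
    (hAtemp : YM.IsTemporal A) (hBtemp : YM.IsTemporal B) :
    (∀ z ∈ N ∩ YM.diamond, YM.dGauge U z (YM.e 0) = 0) ∧
    ∃ V : YM.Spacetime → GL (Fin n) ℂ, YM.IsGauge G V ∧
      (∀ (s t : ℝ) (x : EuclideanSpace ℝ (Fin 3)),
        (s, x) ∈ YM.diamond → (t, x) ∈ YM.diamond → V (s, x) = V (t, x)) ∧
      (∃ N₂ : Set YM.Spacetime, IsOpen N₂ ∧ YM.lowerBdry ⊆ N₂ ∧
        ∀ z ∈ N₂ ∩ YM.diamond, V z = U z) ∧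
      ∀ z ∈ YM.diamond, A z = YM.gaugeAct V B z :=
  mainTheorem7_general n G ε₀ hε₀ A B (hA.contDiffOn.of_le (by norm_num))
    (hB.contDiffOn.of_le (by norm_num)) hAYM hBYM hAB U hU N hN hNbdry hAUB hUid hAtemp hBtemp
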